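/- Let $F$ be a non-archimedean local field with ring of integers $\mathcal O$ and maximal ideal $\mathcal P$, and let $G=\mathrm{PGL}(2,F)$. Let $U\subset G$ be the image of the upper triangular unipotent matrices, $T\subset G$ the image of the diagonal matrices, identified with $F^\times$ by $\mathrm{diag}(a_{11},a_{22})\mapsto a_{11}/a_{22}$, and $T(\mathcal O)\simeq\mathcal O^\times$ its maximal compact subgroup. For $d\ge 0$ let $\Gamma_d\subset G$ be the image of the group of matrices $g\in \mathrm{GL}(2,\mathcal O)$ with $g_{21}\in\mathcal P^d$, and put $K=\Gamma_0$. Put $U_0=\mathcal O^\times$ and $U_r=1+\mathcal P^r$ for $r>0$. Let $x:\mathcal O^\times\to\mathbb C^\times$ be a (continuous) character, let $d=d(x)$ be the least $r\ge 0$ such that $x^2|_{U_r}=1$, and assume $d>0$. For $g\in\Gamma_d$ put $\tilde x(g)=x(g_{11}^2/\det g)$; this is a character of $\Gamma_d$. Let $G$ act by left shifts, $(g f)(h)=f(g^{-1}h)$, on the following spaces. * $V_x$: the locally constant functions $f:G\to\mathbb C$, compactly supported modulo $U$, with $f(gtu)=x(t)f(g)$ for $g\in G$, $t\in T(\mathcal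 O)$, $u\in U$. * $W_x=\mathrm{c\text{-}ind}_{\Gamma_d}^G\tilde x$: the locally constant compactly supported functions $\phi:G\to\mathbb C$ with $\phi(g\gamma)=\tilde x(\gamma)\phi(g)$ for $g\in G$, $\gamma\in\Gamma_d$. Let $f_0\in V_x$ be the function supported on $\Gamma_dU$ with $f_0(\gamma u)=\tilde x(\gamma)$ for $\gamma\in\Gamma_d$, $u\in U$, and let $\phi_0\in W_x$ be the function supported on $\Gamma_d$ and equal to $\tilde x$ there. Let $\mathrm{ch}_{\Gamma_d}$ be the normalized Haar measure on $\Gamma_d$, and put $\mu_0=\phi_0\,\mathrm{ch}_{\Gamma_d}$. For $f\in V_x$ and $\phi\in W_x$ define functions on $G$ by $$A(f)(g)=(f*\mu_0)(g)=\int_{G} f(gh^{-1})\,d\mu_0(h),\qquad B(\phi)(g)=\int_U\phi(gu)\,du,$$ where $du$ is the Haar measure on $U$ with $\int_{U\cap K}du=1$. Then $B$ is a $G$-morphism $W_x\to V_x$, and: a) $B(\phi_0)=f_0$. b) $A(f_0)=\phi_0$. c) $A$ is an isomorphism $V_x\to W_x$ of representations of $G$. d) The $\mathbb C$-algebras $\mathrm{End}_G(V_x)$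 and $\mathrm{End}_G(W_x)$ are isomorphic; conjugation by $A$, $S\mapsto ASA^{-1}$, is an isomorphism. -/

import Mathlib

open ValuativeRel MeasureTheory Matrix
open scoped MatrixGroups Pointwise

noncomputable section

namespace PGLTwo

section Topology

variable (F : Type*) [Field F] [TopologicalSpace F]

/-- `PGL(2, F)` carries the quotient topology from `GL(2, F)`. -/
instance instTopologicalSpace : TopologicalSpace PGL(2, F) :=
  inferInstanceAs (TopologicalSpace (GL (Fin 2) F ⧸ Subgroup.center (GL (Fin 2) F)))

/-- `PGL(2, F)` carries its Borel sigma-algebra. -/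
instance instMeasurableSpace : MeasurableSpace PGL(2, F) := borel _

instance instBorelSpace : BorelSpace PGL(2, F) := ⟨rfl⟩

instance instIsTopologicalGroup [IsTopologicalRing F] : IsTopologicalGroup PGL(2, F) :=
  inferInstanceAs (IsTopologicalGroup (GL (Fin 2) F ⧸ Subgroup.center (GL (Fin 2) F)))

instance instLocallyCompactSpace [IsTopologicalRing F] [T2Space F] [LocallyCompactSpace F] :
    LocallyCompactSpace PGL(2, F) := by
  have : LocallyCompactSpace (Matrix (Fin 2) (Fin 2) F) :=
    inferInstanceAs (LocallyCompactSpace (Fin 2 → Fin 2 → F))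
  have : LocallyCompactSpace (GL (Fin 2) F) :=
    inferInstanceAs (LocallyCompactSpace (Matrix (Fin 2) (Fin 2) F)ˣ)
  exact inferInstanceAs (LocallyCompactSpace (GL (Fin 2) F ⧸ Subgroup.center (GL (Fin 2) F)))

/-- The topology of a local field is Hausdorff. -/
instance instT2Space [ValuativeRel F] [IsNonarchimedeanLocalField F] : T2Space F := by
  let := IsTopologicalAddGroup.rightUniformSpace F
  have := isUniformAddGroup_of_addCommGroup (G := F)
  infer_instance

end Topology

section Groups

variable {F : Type*} [Field F]

/-- The image in `PGL(2, F)` of the upper triangular unipotent matrix `(1, b; 0, 1)`. -/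
def unip (b : F) : PGL(2, F) :=
  ProjGenLinGroup.mk (GeneralLinearGroup.upperRightHom b)

variable (F) in
/-- The subgroup `U` of upper triangular unipotent elements of `PGL(2, F)`. -/
def U : Subgroup PGL(2, F) where
  carrier := Set.range unip
  one_mem' := ⟨0, by simp [unip]⟩
  mul_mem' := by
    rintro _ _ ⟨a, rfl⟩ ⟨b, rfl⟩
    exact ⟨a + b, by simp [unip, AddChar.map_add_eq_mul]⟩
  inv_mem' := by
    rintro _ ⟨a, rfl⟩
    exact ⟨-a, by rw [unip, unip, AddChar.map_neg_eq_inv, map_inv]⟩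

/-- The image in `PGL(2, F)` of the diagonal matrix `diag(a, 1)`. Under the identification
`diag(a₁₁, a₂₂) ↦ a₁₁ / a₂₂` of the diagonal torus with `Fˣ`, this is the element
corresponding to `a`. -/
def tor (a : Fˣ) : PGL(2, F) :=
  ProjGenLinGroup.mk (GeneralLinearGroup.mkOfDetNeZero !![(a : F), 0; 0, 1] (by simp))

/-- The function `g ↦ g₁₁² / det g` on `PGL(2, F)`. -/
def ratio (g : PGL(2, F)) : F :=
  Quotient.lift (s := QuotientGroup.leftRel (Subgroup.center (GL (Fin 2) F)))
    (fun h : GL (Fin 2) F => h 0 0 ^ 2 / Matrix.det (h : Matrix (Fin 2) (Fin 2) F))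
    (by
      intro a b hab
      have h : (ProjGenLinGroup.mk a : PGL(2, F)) = ProjGenLinGroup.mk b := Quotient.sound hab
      obtain ⟨u, rfl⟩ := ProjGenLinGroup.mk_eq_mk_iff.1 h
      have hu : (u : F) ≠ 0 := u.ne_zero
      have hd : Matrix.det (a : Matrix (Fin 2) (Fin 2) F) ≠ 0 := a.det_ne_zero
      simp only [Units.val_mul, GeneralLinearGroup.coe_scalar, Matrix.scalar_apply,
        Matrix.det_mul, Matrix.det_diagonal, Fin.prod_univ_two, Matrix.mul_diagonal]
      field_simp) g

theorem ratio_mk (h : GL (Fin 2) F) :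
    ratio (ProjGenLinGroup.mk h) = h 0 0 ^ 2 / Matrix.det (h : Matrix (Fin 2) (Fin 2) F) :=
  rfl

theorem ratio_mul_unip (g : PGL(2, F)) (b : F) : ratio (g * unip b) = ratio g := by
  induction g using ProjGenLinGroup.induction_on with | mk h =>
  rw [unip, ← map_mul, ratio_mk, ratio_mk]
  simp [GeneralLinearGroup.upperRightHom, Matrix.mul_apply, Fin.sum_univ_two]

end Groups

section Arithmetic

variable {F : Type*} [Field F] [ValuativeRel F]

variable (F) in
/-- The group of matrices in `GL(2, 𝒪)` whose lower left entry lies in `𝓂 ^ d`. -/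
def GammaTilde (d : ℕ) : Subgroup (GL (Fin 2) 𝒪[F]) where
  carrier := {g | g 1 0 ∈ 𝓂[F] ^ d}
  one_mem' := by simp
  mul_mem' := by
    intro a b ha hb
    simp only [Set.mem_ofPred_eq, Units.val_mul, Matrix.mul_apply, Fin.sum_univ_two] at *
    exact add_mem (Ideal.mul_mem_right _ _ ha) (Ideal.mul_mem_left _ _ hb)
  inv_mem' := by
    intro a ha
    simp only [Set.mem_ofPred_eq, GeneralLinearGroup.coe_inv, Matrix.inv_def,
      Matrix.adjugate_fin_two] at *
    simpa using (Ideal.mul_mem_left _ (Ring.inverse a.1.det) (neg_mem ha))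

variable (F) in
/-- The subgroup `Γ_d` of `PGL(2, F)`: the image of the group of matrices in `GL(2, 𝒪)` whose
lower left entry lies in `𝓂 ^ d`. In particular `Γ_0` is the image of `GL(2, 𝒪)`. -/
def Gamma (d : ℕ) : Subgroup PGL(2, F) :=
  (GammaTilde F d).map
    (ProjGenLinGroup.mk.comp (GeneralLinearGroup.map (algebraMap 𝒪[F] F)))

variable (F) in
/-- The filtration subgroups of `𝒪ˣ`: `U_0 = 𝒪ˣ` and `U_r = 1 + 𝓂 ^ r` for `r > 0`. -/
def unitFiltration (r : ℕ) : Set 𝒪[F]ˣ := {u | (u : 𝒪[F]) - 1 ∈ 𝓂[F] ^ r}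

variable [TopologicalSpace F]

/-- The depth `d(x)` of a character `x` of `𝒪ˣ`: the least `r` such that `x ^ 2` is trivial on
the `r`-th filtration subgroup. -/
def depth (x : 𝒪[F]ˣ →ₜ* ℂˣ) : ℕ := sInf {r | ∀ u ∈ unitFiltration F r, x u ^ 2 = 1}

open scoped Classical in
/-- The character `x` of `𝒪ˣ`, viewed as a function on `F` that vanishes outside `𝒪ˣ`. -/
def extChar (x : 𝒪[F]ˣ →ₜ* ℂˣ) (a : F) : ℂ :=
  if h : ∃ u : 𝒪[F]ˣ, ((u : 𝒪[F]) : F) = a then (x h.choose : ℂ) else 0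

theorem extChar_coe (x : 𝒪[F]ˣ →ₜ* ℂˣ) (u : 𝒪[F]ˣ) :
    extChar x ((u : 𝒪[F]) : F) = (x u : ℂ) := by
  have h : ∃ v : 𝒪[F]ˣ, ((v : 𝒪[F]) : F) = ((u : 𝒪[F]) : F) := ⟨u, rfl⟩
  have h' : h.choose = u := Units.ext (Subtype.ext h.choose_spec)
  rw [extChar, dif_pos h, h']

/-- `x̃(g) = x(g₁₁² / det g)`. It is used only for `g` in `Γ_d`, `d = d(x) > 0`, where
`g₁₁² / det g` is a unit of `𝒪`, and for `g` in `Γ_d U`. -/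
def tildeChar (x : 𝒪[F]ˣ →ₜ* ℂˣ) (g : PGL(2, F)) : ℂ := extChar x (ratio g)

/-- `φ₀` is supported on `Γ_d` and equal to `x̃` there. -/
def phi0 (x : 𝒪[F]ˣ →ₜ* ℂˣ) : PGL(2, F) → ℂ :=
  Set.indicator (Gamma F (depth x) : Set PGL(2, F)) (tildeChar x)

/-- `f₀` is supported on `Γ_d U` and `f₀(γ u) = x̃(γ)` for `γ ∈ Γ_d` and `u ∈ U`
(the function `x̃` is right invariant under `U`; see `f0_mul`). -/
def f0 (x : 𝒪[F]ˣ →ₜ* ℂˣ) : PGL(2, F) → ℂ :=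
  Set.indicator ((Gamma F (depth x) : Set PGL(2, F)) * (U F : Set PGL(2, F))) (tildeChar x)

theorem f0_mul (x : 𝒪[F]ˣ →ₜ* ℂˣ) {γ u : PGL(2, F)} (hγ : γ ∈ Gamma F (depth x))
    (hu : u ∈ U F) : f0 x (γ * u) = tildeChar x γ := by
  rw [f0, Set.indicator_of_mem (Set.mul_mem_mul hγ hu)]
  obtain ⟨b, rfl⟩ := hu
  rw [tildeChar, ratio_mul_unip, tildeChar]

end Arithmetic

section Representations

/-- The action of a group on complex functions by left shifts, `(g f)(h) = f(g⁻¹ h)`. -/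
def leftShift (G : Type*) [Group G] : Representation ℂ G (G → ℂ) where
  toFun g :=
    { toFun := fun f h => f (g⁻¹ * h)
      map_add' := fun _ _ => rfl
      map_smul' := fun _ _ => rfl }
  map_one' := by ext; simp
  map_mul' a b := by ext; simp [mul_assoc]

@[simp]
theorem leftShift_apply {G : Type*} [Group G] (g : G) (f : G → ℂ) (h : G) :
    leftShift G g f h = f (g⁻¹ * h) := rfl

variable {F : Type*} [Field F] [ValuativeRel F] [TopologicalSpace F] [IsTopologicalRing F]

/-- `V_x`: the locally constant functions `f` on `G = PGL(2, F)`, compactly supported modulo `U`,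
with `f(g t u) = x(t) f(g)` for `t` in the maximal compact subgroup `T(𝒪) ≃ 𝒪ˣ` of the diagonal
torus and `u ∈ U`. -/
def V (x : 𝒪[F]ˣ →ₜ* ℂˣ) : Subrepresentation (leftShift PGL(2, F)) where
  toSubmodule :=
    { carrier := {f | IsLocallyConstant f ∧
        (∃ C : Set PGL(2, F), IsCompact C ∧ Function.support f ⊆ C * (U F : Set PGL(2, F))) ∧
        ∀ (g : PGL(2, F)) (a : 𝒪[F]ˣ), ∀ u ∈ U F,
          f (g * tor (Units.map (algebraMap 𝒪[F] F).toMonoidHom a) * u) = x a * f g}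
      zero_mem' := ⟨IsLocallyConstant.const 0, ⟨∅, isCompact_empty, by simp⟩, by simp⟩
      add_mem' := by
        rintro f f' ⟨h1, ⟨C, hC, hs⟩, h3⟩ ⟨h1', ⟨C', hC', hs'⟩, h3'⟩
        refine ⟨h1.add h1', ⟨C ∪ C', hC.union hC', ?_⟩, fun g a u hu => ?_⟩
        · rw [Set.union_mul]
          exact (Function.support_add f f').trans (Set.union_subset_union hs hs')
        · simp only [Pi.add_apply, h3 g a u hu, h3' g a u hu, mul_add]
      smul_mem' := by
        rintro c f ⟨h1, ⟨C, hC, hs⟩, h3⟩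
        refine ⟨h1.comp (c • ·), ⟨C, hC, (Function.support_const_smul_subset c f).trans hs⟩,
          fun g a u hu => ?_⟩
        simp only [Pi.smul_apply, smul_eq_mul, h3 g a u hu, mul_left_comm] }
  apply_mem_toSubmodule := by
    rintro g f ⟨h1, ⟨C, hC, hs⟩, h3⟩
    refine ⟨h1.comp_continuous (continuous_const_mul g⁻¹), ⟨g • C, hC.smul g, fun h hh => ?_⟩,
      fun h a u hu => ?_⟩
    · obtain ⟨c, hc, u, hu, hcu⟩ := hs (show g⁻¹ * h ∈ Function.support f from hh)
      refine ⟨g * c, ⟨c, hc, rfl⟩, u, hu, ?_⟩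
      simp only [mul_assoc] at hcu ⊢
      rw [hcu, mul_inv_cancel_left]
    · simpa only [leftShift_apply, mul_assoc] using h3 (g⁻¹ * h) a u hu

/-- `W_x`: the locally constant, compactly supported functions `φ` on `G = PGL(2, F)` with
`φ(g γ) = x̃(γ) φ(g)` for `γ ∈ Γ_d`, `d = d(x)`. -/
def W (x : 𝒪[F]ˣ →ₜ* ℂˣ) : Subrepresentation (leftShift PGL(2, F)) where
  toSubmodule :=
    { carrier := {φ | IsLocallyConstant φ ∧ HasCompactSupport φ ∧
        ∀ (g : PGL(2, F)), ∀ γ ∈ Gamma F (depth x), φ (g * γ) = tildeChar x γ * φ g}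
      zero_mem' := ⟨IsLocallyConstant.const 0, HasCompactSupport.zero, by simp⟩
      add_mem' := by
        rintro f f' ⟨h1, h2, h3⟩ ⟨h1', h2', h3'⟩
        refine ⟨h1.add h1', h2.add h2', fun g γ hγ => ?_⟩
        simp only [Pi.add_apply, h3 g γ hγ, h3' g γ hγ, mul_add]
      smul_mem' := by
        rintro c f ⟨h1, h2, h3⟩
        refine ⟨h1.comp (c • ·), h2.smul_left (f := fun _ => c), fun g γ hγ => ?_⟩
        simp only [Pi.smul_apply, smul_eq_mul, h3 g γ hγ, mul_left_comm] }
  apply_mem_toSubmodule := by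
    rintro g f ⟨h1, h2, h3⟩
    refine ⟨h1.comp_continuous (continuous_const_mul g⁻¹),
      h2.comp_homeomorph (Homeomorph.mulLeft g⁻¹), fun h γ hγ => ?_⟩
    simpa only [leftShift_apply, mul_assoc] using h3 (g⁻¹ * h) γ hγ

/-- The representation `τ_x` of `G` by left shifts on `V_x`. -/
abbrev tau (x : 𝒪[F]ˣ →ₜ* ℂˣ) : Representation ℂ PGL(2, F) (V x).toSubmodule :=
  (V x).toRepresentation

/-- The representation of `G` by left shifts on `W_x`. -/
abbrev rho (x : 𝒪[F]ˣ →ₜ* ℂˣ) : Representation ℂ PGL(2, F) (W x).toSubmodule :=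
  (W x).toRepresentation

end Representations

section Operators

variable {F : Type*} [Field F] [ValuativeRel F] [TopologicalSpace F]
  [IsNonarchimedeanLocalField F]

/-- `ch_R`, the normalized Haar measure on an open compact subgroup `R`, as a measure on `G`. -/
def ch (R : Subgroup PGL(2, F)) : Measure PGL(2, F) :=
  (Measure.haar (R : Set PGL(2, F)))⁻¹ • Measure.haar.restrict (R : Set PGL(2, F))

/-- The convolution `f ∗ (φ ν)` of a function `f` with the measure `φ ν` having density `φ` with
respect to `ν`: `(f ∗ μ)(g) = ∫ f(g h⁻¹) dμ(h)`. -/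
def conv (f φ : PGL(2, F) → ℂ) (ν : Measure PGL(2, F)) (g : PGL(2, F)) : ℂ :=
  ∫ h, f (g * h⁻¹) * φ h ∂ν

/-- `A(f) = f ∗ μ₀` with `μ₀ = φ₀ ch_{Γ_d}`. -/
def opA (x : 𝒪[F]ˣ →ₜ* ℂˣ) (f : PGL(2, F) → ℂ) : PGL(2, F) → ℂ :=
  conv f (phi0 x) (ch (Gamma F (depth x)))

/-- `B(φ)(g) = ∫_U φ(g u) du`, where `du` is the Haar measure on `U ≃ F` normalized so that
`U ∩ K ≃ 𝒪` has volume one. -/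
def opB (φ : PGL(2, F) → ℂ) (g : PGL(2, F)) : ℂ :=
  letI : MeasurableSpace F := borel F
  haveI : BorelSpace F := ⟨rfl⟩
  ∫ b : F, φ (g * unip b) ∂((Measure.addHaar (𝒪[F] : Set F))⁻¹ • (Measure.addHaar : Measure F))

end Operators

end PGLTwo

end

/-!
Both representations are cyclic: `W_x` is generated by `φ₀`, and `V_x` by `f₀`. Since `A` and `B`
are intertwining operators with `A f₀ = φ₀` and `B φ₀ = f₀`, they are mutually inverse.

That `φ₀` generates `W_x` is the decomposition of a compact set into cosets of `Γ_d`. For `V_x`,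
averaging the translates of `f₀` under suitable unipotent elements shrinks its support `Γ_d U` to
`Γ_m U` for every `m ≥ d`; a function in `V_x` is a finite linear combination of translates of
the resulting functions. The other terms of the averages cancel because `x ^ 2` is non-trivial on
`U_{d-1}`. The same fact makes `A f₀` vanish off `Γ_d`: its values on `Γ_d (1, b; 0, 1) Γ_d` with
`|b| > 1` are multiplied by some `x(z ^ 2) ≠ 1` without changing.
-/

noncomputable section

namespace PGLTwo

section CyclicVectors

variable {k G M N : Type*} [CommSemiring k] [Monoid G] [AddCommMonoid M] [AddCommMonoid N]
  [Module k M] [Module k N] {ρ : Representation k G M} {σ : Representation k G N} {v : M}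

variable (ρ v) in
/-- The subrepresentation generated by a vector `v`: the span of its translates. The vector is
cyclic when this is the whole space. -/
def generatedBy : Subrepresentation ρ where
  toSubmodule := Submodule.span k (Set.range fun g => ρ g v)
  apply_mem_toSubmodule g := by
    suffices Submodule.span k (Set.range fun g => ρ g v) ≤
      (Submodule.span k (Set.range fun g => ρ g v)).comap (ρ g) from fun _ hw => this hw
    rw [Submodule.span_le]
    rintro _ ⟨h, rfl⟩
    exact Submodule.subset_span ⟨g * h, by simp only [map_mul, Module.End.mul_apply]⟩

theorem mem_generatedBy_self : v ∈ generatedBy ρ v :=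
  Submodule.subset_span ⟨1, by simp only [map_one, Module.End.one_apply]⟩

theorem generatedBy_le {S : Subrepresentation ρ} (hv : v ∈ S) : generatedBy ρ v ≤ S := by
  change (generatedBy ρ v).toSubmodule ≤ S.toSubmodule
  rw [generatedBy, Submodule.span_le]
  rintro _ ⟨g, rfl⟩
  exact S.apply_mem_toSubmodule g hv

theorem generatedBy_toRepresentation_eq_top {S : Subrepresentation ρ} (hv : v ∈ S)
    (hS : S ≤ generatedBy ρ v) : generatedBy S.toRepresentation ⟨v, hv⟩ = ⊤ := by
  refine top_unique fun w _ => ?_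
  have himage : ((generatedBy S.toRepresentation ⟨v, hv⟩).toSubmodule.map S.toSubmodule.subtype) =
      (generatedBy ρ v).toSubmodule := by
    rw [generatedBy, generatedBy, Submodule.map_span, ← Set.range_comp]
    rfl
  obtain ⟨w', hw', hww'⟩ := himage.ge (hS w.2)
  rwa [← Subtype.ext hww']

theorem apply_mem_of_generatedBy_eq_top (hv : generatedBy ρ v = ⊤) (T : ρ.IntertwiningMap σ)
    {S : Subrepresentation σ} (hT : T v ∈ S) (m : M) : T m ∈ S := by
  let preimage : Subrepresentation ρ :=
    { toSubmodule := S.toSubmodule.comap T.toLinearMap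
      apply_mem_toSubmodule := fun g w hw => by
        change T (ρ g w) ∈ S
        rw [T.isIntertwining]
        exact S.apply_mem_toSubmodule g hw }
  have htop : generatedBy ρ v ≤ preimage := generatedBy_le hT
  exact htop (hv.ge trivial)

theorem intertwiningMap_ext_of_generatedBy_eq_top (hv : generatedBy ρ v = ⊤)
    {S T : ρ.IntertwiningMap σ} (h : S v = T v) : S = T := by
  let equalizer : Subrepresentation ρ :=
    { toSubmodule := LinearMap.eqLocus S.toLinearMap T.toLinearMap
      apply_mem_toSubmodule := fun g w (hw : S w = T w) => by
        change S (ρ g w) = T (ρ g w)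
        rw [S.isIntertwining, T.isIntertwining, hw] }
  have htop : generatedBy ρ v ≤ equalizer := generatedBy_le h
  exact Representation.IntertwiningMap.ext (LinearMap.ext fun w => htop (hv.ge (Set.mem_univ w)))

/-- An intertwining map with values in a subrepresentation, as a map into it. -/
def codRestrict (S : Subrepresentation σ) (T : ρ.IntertwiningMap σ) (hT : ∀ m, T m ∈ S) :
    ρ.IntertwiningMap S.toRepresentation where
  toLinearMap := T.toLinearMap.codRestrict S.toSubmodule hT
  isIntertwining' g := LinearMap.ext fun m => Subtype.ext (T.isIntertwining _ _ g m)

/-- Intertwining maps which exchange two cyclic vectors are mutually inverse. -/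
def equivOfGeneratedByEqTop {w : N} (hv : generatedBy ρ v = ⊤) (hw : generatedBy σ w = ⊤)
    (A : ρ.IntertwiningMap σ) (B : σ.IntertwiningMap ρ) (hA : A v = w) (hB : B w = v) :
    ρ.Equiv σ where
  toIntertwiningMap := A
  invFun := B
  left_inv := by
    have hBA : B.comp A = .id ρ := intertwiningMap_ext_of_generatedBy_eq_top hv
      (by rw [Representation.IntertwiningMap.comp_apply, hA, hB]; rfl)
    exact fun m => DFunLike.congr_fun hBA m
  right_inv := by
    have hAB : A.comp B = .id σ := intertwiningMap_ext_of_generatedBy_eq_top hw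
      (by rw [Representation.IntertwiningMap.comp_apply, hB, hA]; rfl)
    exact fun n => DFunLike.congr_fun hAB n

/-- Conjugation by an isomorphism of representations, as an isomorphism of endomorphism
algebras. -/
def endConj (A : ρ.Equiv σ) : ρ.IntertwiningMap ρ ≃ₐ[k] σ.IntertwiningMap σ :=
  AlgEquiv.ofLinearEquiv
    { toFun := fun S => (A.toIntertwiningMap.comp S).comp A.symm.toIntertwiningMap
      map_add' := fun S T => by ext; simp
      map_smul' := fun c S => by ext; simp
      invFun := fun S => (A.symm.toIntertwiningMap.comp S).comp A.toIntertwiningMap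
      left_inv := fun S => by ext; simp
      right_inv := fun S => by ext; simp }
    (by ext; simp) (fun S T => by ext; simp)

theorem endConj_apply_apply (A : ρ.Equiv σ) (S : ρ.IntertwiningMap ρ) (m : M) :
    endConj A S (A m) = A (S m) :=
  congrArg (fun n => A (S n)) (A.symm_apply_apply m)

end CyclicVectors

section Valuation

variable {F : Type*} [Field F] [ValuativeRel F]

theorem valuation_coe_units (u : 𝒪[F]ˣ) : valuation F (u : 𝒪[F]) = 1 :=
  (Valuation.integer.integers (valuation F)).valuation_unit u

theorem exists_units_coe_eq {a : F} (ha : valuation F a = 1) :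
    ∃ u : 𝒪[F]ˣ, ((u : 𝒪[F]) : F) = a := by
  obtain ⟨u, hu⟩ := (Valuation.integer.integers (valuation F)).isUnit_iff_valuation_eq_one
    (x := ⟨a, ha.le⟩).2 ha
  exact ⟨u, by rw [hu]⟩

theorem valuation_eq_one_of_sub_lt {a b : F} (ha : valuation F a = 1)
    (h : valuation F (b - a) < 1) : valuation F b = 1 :=
  ha ▸ Valuation.map_eq_of_sub_lt _ (ha.symm ▸ h)

variable [TopologicalSpace F] [IsNonarchimedeanLocalField F]

theorem uniformizer_pow_le_one (m : ℕ) : uniformizer F ^ m ≤ 1 :=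
  pow_le_one₀ zero_le uniformizer_lt_one.le

theorem uniformizer_pow_lt_one {m : ℕ} (hm : 0 < m) : uniformizer F ^ m < 1 :=
  pow_lt_one₀ zero_le uniformizer_lt_one hm.ne'

theorem uniformizer_pow_le_pow {m n : ℕ} (h : m ≤ n) : uniformizer F ^ n ≤ uniformizer F ^ m :=
  pow_le_pow_right_of_le_one' uniformizer_lt_one.le h

theorem mem_maximalIdeal_pow_iff (a : 𝒪[F]) (m : ℕ) :
    a ∈ 𝓂[F] ^ m ↔ valuation F a ≤ uniformizer F ^ m := by
  obtain ⟨p, hp⟩ := IsDiscreteValuationRing.exists_irreducible 𝒪[F]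
  have hval : valuation F p = uniformizer F := by
    refine le_antisymm (le_uniformizer_iff.2 (lt_of_le_of_ne p.2 fun h => hp.not_isUnit
      ((Valuation.integer.integers _).isUnit_iff_valuation_eq_one.2 h))) ?_
    obtain ⟨q, hq⟩ := valuation_surjective (uniformizer F)
    have hq1 : valuation F q < 1 := hq.trans_lt uniformizer_lt_one
    have hmem : (⟨q, hq1.le⟩ : 𝒪[F]) ∈ 𝓂[F] := fun h =>
      hq1.ne ((Valuation.integer.integers _).isUnit_iff_valuation_eq_one.1 h)
    rw [← hq]
    exact (Set.ext_iff.1 (hp.maximalIdeal_eq_setOfPred_le_v_coe (valuation F)) _).1 hmem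
  rw [← hval]
  exact Set.ext_iff.1 (hp.maximalIdeal_pow_eq_setOfPred_le_v_coe_pow (valuation F) m) a

variable (F) in
/-- A uniformizer of `F`, as an element of `Fˣ`. -/
def varpi : Fˣ :=
  Units.mk0 (valuation_surjective (uniformizer F)).choose fun h =>
    uniformizer_ne_zero (R := F)
      (by rw [← (valuation_surjective (uniformizer F)).choose_spec, h, map_zero])

theorem valuation_varpi_zpow (n : ℤ) :
    valuation F ((varpi F ^ n : Fˣ) : F) = uniformizer F ^ n := by
  rw [Units.val_zpow_eq_zpow_val, map_zpow₀]
  exact congrArg (· ^ n) (valuation_surjective (uniformizer F)).choose_spec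

theorem valuation_varpi_zpow_injective :
    Function.Injective fun n : ℤ => valuation F ((varpi F ^ n : Fˣ) : F) := by
  simp only [valuation_varpi_zpow]
  exact zpow_right_injective₀ (zero_lt_iff.2 uniformizer_ne_zero) uniformizer_lt_one.ne

theorem exists_valuation_eq_uniformizer_zpow {a : F} (ha : a ≠ 0) :
    ∃ n : ℤ, valuation F a = uniformizer F ^ n := by
  let p := Units.mk0 (uniformizer F) uniformizer_ne_zero
  let γ := Units.mk0 (valuation F a) ((valuation F).ne_zero_iff.2 ha)
  have hp : 1 < p⁻¹ := one_lt_inv'.2 (Units.val_lt_val.1 uniformizer_lt_one)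
  obtain ⟨n, ⟨hle, hlt⟩, -⟩ := existsUnique_div_zpow_mem_Ico hp γ 1
  have hle' : γ / p⁻¹ ^ n ≤ 1 := by
    rw [one_mul, ← not_le, ← Units.val_le_val] at hlt
    exact not_lt.1 fun h => hlt (by simpa [p] using uniformizer_inv_le_iff.2 h)
  have h := div_eq_one.1 (le_antisymm hle' hle)
  exact ⟨-n, by simpa [p, γ] using congrArg Units.val h⟩

theorem valuation_eq_uniformizer_pow {a : F} {m : ℕ} (hle : valuation F a ≤ uniformizer F ^ m)
    (hnot : ¬ valuation F a ≤ uniformizer F ^ (m + 1)) :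
    valuation F a = uniformizer F ^ m := by
  have ha : a ≠ 0 := fun h => hnot (by simp only [h, map_zero, zero_le])
  obtain ⟨n, hn⟩ := exists_valuation_eq_uniformizer_zpow ha
  have hpos : 0 < uniformizer F := zero_lt_iff.2 uniformizer_ne_zero
  rw [hn, ← zpow_natCast, zpow_le_zpow_iff_right_of_lt_one₀ hpos uniformizer_lt_one] at hle hnot
  rw [hn, ← zpow_natCast, show n = m by lia]

theorem isOpen_setOf_valuation_le {γ : ValueGroupWithZero F} (hγ : γ ≠ 0) :
    IsOpen {a : F | valuation F a ≤ γ} := by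
  refine isOpen_iff_mem_nhds.2 fun a ha => (IsValuativeTopology.mem_nhds_iff' ..).2
    ⟨Units.mk0 γ hγ, fun b hb => ?_⟩
  rw [← add_sub_cancel a b]
  exact (valuation F).map_add_le ha (le_of_lt hb)

theorem exists_uniformizer_pow_of_eventually {p : F → Prop} (hp : ∀ᶠ a in nhds 0, p a) :
    ∃ m : ℕ, ∀ a : F, valuation F a ≤ uniformizer F ^ m → p a := by
  obtain ⟨γ, hγ⟩ := (IsValuativeTopology.mem_nhds_zero_iff _).1 hp
  obtain ⟨m, hm⟩ := exists_pow_lt₀ (uniformizer_lt_one (R := F)) γ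
  exact ⟨m, fun a ha => hγ (ha.trans_lt hm)⟩

end Valuation

section Character

variable {F : Type*} [Field F] [ValuativeRel F] [TopologicalSpace F] (x : 𝒪[F]ˣ →ₜ* ℂˣ)

theorem extChar_eq_zero {a : F} (ha : valuation F a ≠ 1) : extChar x a = 0 := by
  refine dif_neg fun ⟨u, hu⟩ => ha ?_
  rw [← hu, valuation_coe_units]

theorem extChar_ne_zero {a : F} (ha : valuation F a = 1) : extChar x a ≠ 0 := by
  obtain ⟨u, rfl⟩ := exists_units_coe_eq ha
  rw [extChar_coe]
  exact Units.ne_zero _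

variable {x} in
theorem valuation_eq_one_of_extChar_ne_zero {a : F} (ha : extChar x a ≠ 0) : valuation F a = 1 :=
  not_imp_comm.1 (extChar_eq_zero x) ha

theorem extChar_one : extChar x (1 : F) = 1 := by
  simpa using extChar_coe x 1

theorem extChar_mul {a : F} (ha : valuation F a = 1) (b : F) :
    extChar x (a * b) = extChar x a * extChar x b := by
  by_cases hb : valuation F b = 1
  · obtain ⟨u, rfl⟩ := exists_units_coe_eq ha
    obtain ⟨w, rfl⟩ := exists_units_coe_eq hb
    have huw := extChar_coe x (u * w)
    rwa [map_mul, Units.val_mul, Subring.coe_mul, Units.val_mul, ← extChar_coe,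
      ← extChar_coe] at huw
  · rw [extChar_eq_zero x hb, mul_zero, extChar_eq_zero]
    rwa [map_mul, ha, one_mul]

theorem extChar_sq {a : F} (ha : valuation F a = 1) : extChar x (a ^ 2) = extChar x a ^ 2 := by
  rw [sq, sq, extChar_mul x ha]

variable [IsNonarchimedeanLocalField F]

theorem extChar_sq_eq_one (hx : 0 < depth x) {a : F}
    (ha : valuation F (a - 1) ≤ uniformizer F ^ depth x) : extChar x (a ^ 2) = 1 := by
  have h1 : valuation F a = 1 :=
    valuation_eq_one_of_sub_lt (map_one _) (ha.trans_lt (uniformizer_pow_lt_one hx))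
  obtain ⟨u, rfl⟩ := exists_units_coe_eq h1
  have hne : {r | ∀ u ∈ unitFiltration F r, x u ^ 2 = 1}.Nonempty := Nat.nonempty_of_pos_sInf hx
  have hu : x u ^ 2 = 1 := Nat.sInf_mem hne u ((mem_maximalIdeal_pow_iff _ _).2 ha)
  rw [extChar_sq x h1, extChar_coe, ← Units.val_pow_eq_pow_val, hu, Units.val_one]

theorem exists_extChar_sq_ne_one (hx : 0 < depth x) :
    ∃ z : F, valuation F (z - 1) ≤ uniformizer F ^ (depth x - 1) ∧ valuation F z = 1 ∧
      extChar x (z ^ 2) ≠ 1 := by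
  have h := Nat.notMem_of_lt_sInf (Nat.sub_lt hx one_pos : depth x - 1 < depth x)
  simp only [Set.mem_ofPred_eq, not_forall] at h
  obtain ⟨u, hu, hu2⟩ := h
  refine ⟨(u : 𝒪[F]), (mem_maximalIdeal_pow_iff _ _).1 hu, valuation_coe_units u, ?_⟩
  rw [extChar_sq x (valuation_coe_units u), extChar_coe, ← Units.val_pow_eq_pow_val]
  exact fun h => hu2 (Units.ext h)

theorem eventually_extChar_ne_neg_one : ∀ᶠ a : F in nhds 1, extChar x a ≠ -1 := by
  have hemb : Topology.IsInducing fun u : 𝒪[F]ˣ => ((u : 𝒪[F]) : F) :=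
    ((continuous_subtype_val.comp Units.continuous_val).isClosedEmbedding
      (Subtype.val_injective.comp Units.val_injective)).isInducing
  have hcont : ∀ᶠ u : 𝒪[F]ˣ in nhds 1, ((x u : ℂˣ) : ℂ) ≠ -1 :=
    (Units.continuous_val.comp (map_continuous x)).continuousAt.eventually_ne
      (by simpa using (by norm_num : (1 : ℂ) ≠ -1))
  rw [hemb.nhds_eq_comap, Filter.eventually_comap] at hcont
  filter_upwards [hcont] with a ha
  by_cases h1 : valuation F a = 1
  · obtain ⟨u, rfl⟩ := exists_units_coe_eq h1
    rw [extChar_coe]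
    exact ha u rfl
  · rw [extChar_eq_zero x h1]
    norm_num

/-- On `U_d`, `d = d(x)`, the values of `x` are `±1`, and `-1` is avoided near `1`. -/
theorem eventually_extChar_eq_one (hx : 0 < depth x) : ∀ᶠ a : F in nhds 1, extChar x a = 1 := by
  have hU : ∀ᶠ a : F in nhds 1, valuation F (a - 1) ≤ uniformizer F ^ depth x := by
    have hsub : Filter.Tendsto (fun a : F => a - 1) (nhds 1) (nhds 0) := by
      simpa using (continuous_sub_right (1 : F)).tendsto 1
    exact hsub.eventually ((isOpen_setOf_valuation_le
      (pow_ne_zero _ uniformizer_ne_zero)).eventually_mem (by simp))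
  filter_upwards [eventually_extChar_ne_neg_one x, hU] with a hne ha
  have h1 : valuation F a = 1 :=
    valuation_eq_one_of_sub_lt (map_one _) (ha.trans_lt (uniformizer_pow_lt_one hx))
  have hsq := extChar_sq_eq_one x hx ha
  rw [extChar_sq x h1] at hsq
  exact (sq_eq_one_iff.1 hsq).resolve_right hne

end Character

section Coordinates

variable {F : Type*} [Field F]

/-- The function `g ↦ g₂₁ / g₁₁` on `PGL(2, F)`, with the junk value `0` where `g₁₁ = 0`. With
`ratio` it is a coordinate on `PGL(2, F) / U`. -/
def slope (g : PGL(2, F)) : F :=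
  Quotient.lift (s := QuotientGroup.leftRel (Subgroup.center (GL (Fin 2) F)))
    (fun h : GL (Fin 2) F => h 1 0 / h 0 0)
    (by
      intro a b hab
      have h : (ProjGenLinGroup.mk a : PGL(2, F)) = ProjGenLinGroup.mk b := Quotient.sound hab
      obtain ⟨u, rfl⟩ := ProjGenLinGroup.mk_eq_mk_iff.1 h
      simp only [Units.val_mul, GeneralLinearGroup.coe_scalar, Matrix.scalar_apply,
        Matrix.mul_diagonal]
      rw [mul_div_mul_right _ _ u.ne_zero]) g

/-- The image in `PGL(2, F)` of the lower triangular unipotent matrix `(1, 0; r, 1)`. -/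
def lowUnip (r : F) : PGL(2, F) :=
  ProjGenLinGroup.mk (GeneralLinearGroup.mkOfDetNeZero !![1, 0; r, 1] (by simp))

theorem slope_mk (h : GL (Fin 2) F) : slope (ProjGenLinGroup.mk h) = h 1 0 / h 0 0 :=
  rfl

theorem ratio_mk_eq_div (h : GL (Fin 2) F) :
    ratio (ProjGenLinGroup.mk h) = h 0 0 ^ 2 / (h 0 0 * h 1 1 - h 0 1 * h 1 0) := by
  rw [ratio_mk, Matrix.det_fin_two]

theorem det_entries_ne_zero (h : GL (Fin 2) F) : h 0 0 * h 1 1 - h 0 1 * h 1 0 ≠ 0 := by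
  rw [← Matrix.det_fin_two]
  exact h.det_ne_zero

theorem ratio_mk_ne_zero_iff {h : GL (Fin 2) F} :
    ratio (ProjGenLinGroup.mk h) ≠ 0 ↔ h 0 0 ≠ 0 := by
  simp only [ratio_mk_eq_div, ne_eq, div_eq_zero_iff, sq_eq_zero_iff, det_entries_ne_zero,
    or_false]

theorem unip_eq_mk (b : F) :
    unip b = ProjGenLinGroup.mk (GeneralLinearGroup.mkOfDetNeZero !![1, b; 0, 1] (by simp)) :=
  congrArg ProjGenLinGroup.mk (Units.ext rfl)

theorem mkOfDetNeZero_apply (M : Matrix (Fin 2) (Fin 2) F) (hM : M.det ≠ 0) (i j : Fin 2) :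
    GeneralLinearGroup.mkOfDetNeZero M hM i j = M i j :=
  rfl

theorem mkOfDetNeZero_mul (M N : Matrix (Fin 2) (Fin 2) F) (hM : M.det ≠ 0) (hN : N.det ≠ 0) :
    GeneralLinearGroup.mkOfDetNeZero M hM * GeneralLinearGroup.mkOfDetNeZero N hN =
      GeneralLinearGroup.mkOfDetNeZero (M * N) (by simp [hM, hN]) :=
  Units.ext rfl

theorem unip_zero : unip (0 : F) = 1 := by
  rw [unip, AddChar.map_zero_eq_one, map_one]

theorem unip_add (a b : F) : unip (a + b) = unip a * unip b := by
  rw [unip, AddChar.map_add_eq_mul, map_mul, unip, unip]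

theorem tor_mul (a b : Fˣ) : tor (a * b) = tor a * tor b := by
  rw [tor, tor, tor, ← map_mul, mkOfDetNeZero_mul]
  simp

theorem tor_one : tor (1 : Fˣ) = 1 := by
  rw [← ProjGenLinGroup.mk_one, tor]
  exact congrArg ProjGenLinGroup.mk (Units.ext Matrix.one_fin_two.symm)

theorem lowUnip_zero : lowUnip (0 : F) = 1 := by
  rw [← ProjGenLinGroup.mk_one, lowUnip]
  exact congrArg ProjGenLinGroup.mk (Units.ext Matrix.one_fin_two.symm)

theorem inv_tor (a : Fˣ) : (tor a)⁻¹ = tor a⁻¹ :=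
  inv_eq_of_mul_eq_one_right (by rw [← tor_mul, mul_inv_cancel, tor_one])

theorem inv_unip (b : F) : (unip b)⁻¹ = unip (-b) :=
  inv_eq_of_mul_eq_one_right (by rw [← unip_add, add_neg_cancel, unip_zero])

theorem unip_mul_tor (a : Fˣ) (b : F) : unip b * tor a = tor a * unip ((a : F)⁻¹ * b) := by
  rw [unip_eq_mk, unip_eq_mk, tor, ← map_mul, ← map_mul, mkOfDetNeZero_mul, mkOfDetNeZero_mul]
  simp

theorem ratio_one : ratio (1 : PGL(2, F)) = 1 := by
  rw [← ProjGenLinGroup.mk_one, ratio_mk]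
  simp

theorem slope_mul_unip (g : PGL(2, F)) (b : F) : slope (g * unip b) = slope g := by
  induction g using ProjGenLinGroup.induction_on with | mk h =>
  rw [unip_eq_mk, ← map_mul, slope_mk, slope_mk]
  simp [Matrix.mul_apply]

theorem ratio_mul_tor (g : PGL(2, F)) (a : Fˣ) : ratio (g * tor a) = a * ratio g := by
  induction g using ProjGenLinGroup.induction_on with | mk h =>
  have hentries : ∀ i, (h * GeneralLinearGroup.mkOfDetNeZero !![(a : F), 0; 0, 1] (by simp)) i 0 =
      h i 0 * a ∧ (h * GeneralLinearGroup.mkOfDetNeZero !![(a : F), 0; 0, 1] (by simp)) i 1 =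
      h i 1 := fun i => by simp [Matrix.mul_apply]
  have := det_entries_ne_zero h
  rw [tor, ← map_mul, ratio_mk_eq_div, ratio_mk_eq_div]
  simp only [hentries]
  field_simp

theorem slope_mul_tor (g : PGL(2, F)) (a : Fˣ) : slope (g * tor a) = slope g := by
  induction g using ProjGenLinGroup.induction_on with | mk h =>
  rw [tor, ← map_mul, slope_mk, slope_mk]
  simp [Matrix.mul_apply, mul_div_mul_right]

theorem ratio_mk_mul (M : Matrix (Fin 2) (Fin 2) F) (hM : M.det ≠ 0) {g : PGL(2, F)}
    (hg : ratio g ≠ 0) :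
    ratio (ProjGenLinGroup.mk (GeneralLinearGroup.mkOfDetNeZero M hM) * g) =
      (M 0 0 + M 0 1 * slope g) ^ 2 / M.det * ratio g := by
  induction g using ProjGenLinGroup.induction_on with | mk h =>
  have h0 := ratio_mk_ne_zero_iff.1 hg
  rw [← map_mul, ratio_mk, ratio_mk, slope_mk, Units.val_mul, Matrix.det_mul, Matrix.mul_apply,
    Fin.sum_univ_two, mkOfDetNeZero_apply, mkOfDetNeZero_apply]
  change _ / (M.det * _) = _
  field_simp

theorem slope_mk_mul (M : Matrix (Fin 2) (Fin 2) F) (hM : M.det ≠ 0) {g : PGL(2, F)}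
    (hg : ratio g ≠ 0) :
    slope (ProjGenLinGroup.mk (GeneralLinearGroup.mkOfDetNeZero M hM) * g) =
      (M 1 0 + M 1 1 * slope g) / (M 0 0 + M 0 1 * slope g) := by
  induction g using ProjGenLinGroup.induction_on with | mk h =>
  have h0 := ratio_mk_ne_zero_iff.1 hg
  rw [← map_mul, slope_mk, slope_mk]
  simp only [Units.val_mul, Matrix.mul_apply, Fin.sum_univ_two, mkOfDetNeZero_apply]
  rw [← mul_div_mul_right (_ + _ * _) _ h0]
  field_simp

theorem ratio_lowUnip_mul (r : F) {g : PGL(2, F)} (hg : ratio g ≠ 0) :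
    ratio (lowUnip r * g) = ratio g := by
  rw [lowUnip, ratio_mk_mul _ _ hg]
  simp

theorem ratio_tor_mul (a : Fˣ) {g : PGL(2, F)} (hg : ratio g ≠ 0) :
    ratio (tor a * g) = a * ratio g := by
  rw [tor, ratio_mk_mul _ _ hg]
  simp [sq]

theorem slope_tor_mul (a : Fˣ) {g : PGL(2, F)} (hg : ratio g ≠ 0) :
    slope (tor a * g) = (a : F)⁻¹ * slope g := by
  rw [tor, slope_mk_mul _ _ hg]
  simp [div_eq_inv_mul]

theorem ratio_unip_mul (b : F) {g : PGL(2, F)} (hg : ratio g ≠ 0) :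
    ratio (unip b * g) = (1 + b * slope g) ^ 2 * ratio g := by
  rw [unip_eq_mk, ratio_mk_mul _ _ hg]
  simp

theorem slope_unip_mul (b : F) {g : PGL(2, F)} (hg : ratio g ≠ 0) :
    slope (unip b * g) = slope g / (1 + b * slope g) := by
  rw [unip_eq_mk, slope_mk_mul _ _ hg]
  simp

theorem exists_eq_lowUnip_mul_tor_mul_unip {g : PGL(2, F)} (hg : ratio g ≠ 0) :
    ∃ b, g = lowUnip (slope g) * tor (Units.mk0 (ratio g) hg) * unip b := by
  induction g using ProjGenLinGroup.induction_on with | mk h =>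
  have h0 := ratio_mk_ne_zero_iff.1 hg
  obtain ⟨D, hD⟩ : ∃ D, h 0 0 * h 1 1 - h 0 1 * h 1 0 = D := ⟨_, rfl⟩
  have hD0 : D ≠ 0 := hD ▸ det_entries_ne_zero h
  refine ⟨h 0 1 / h 0 0, ?_⟩
  rw [slope_mk, lowUnip, unip_eq_mk, tor, ← map_mul, ← map_mul, eq_comm,
    ProjGenLinGroup.mk_eq_mk_iff]
  refine ⟨Units.mk0 (D / h 0 0) (div_ne_zero hD0 h0), ?_⟩
  rw [mkOfDetNeZero_mul, mkOfDetNeZero_mul]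
  ext i j
  fin_cases i <;> fin_cases j <;>
    simp [Matrix.mul_apply, Matrix.scalar_apply, ratio_mk_eq_div, hD] <;>
    field_simp
  linear_combination -hD

theorem lowUnip_mul_tor_mul_unip_eq {b : F} (hb : b ≠ 0) (z : Fˣ) :
    lowUnip ((1 - z) / b) * tor z⁻¹ * unip b =
      unip b * (lowUnip ((1 - z) / (b * z)) * tor z) := by
  rw [lowUnip, lowUnip, unip_eq_mk, tor, tor, ← map_mul, ← map_mul, ← map_mul, ← map_mul,
    mkOfDetNeZero_mul, mkOfDetNeZero_mul, mkOfDetNeZero_mul, mkOfDetNeZero_mul,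
    ProjGenLinGroup.mk_eq_mk_iff]
  refine ⟨z, ?_⟩
  ext i j
  fin_cases i <;> fin_cases j <;> simp [Matrix.mul_apply, Matrix.scalar_apply] <;> field_simp <;>
    ring

end Coordinates

section CongruenceSubgroups

variable {F : Type*} [Field F] [ValuativeRel F] [TopologicalSpace F]
  [IsNonarchimedeanLocalField F]

theorem mk_mem_Gamma {d : ℕ} {h : GL (Fin 2) F} (hint : ∀ i j, valuation F (h i j) ≤ 1)
    (hdet : valuation F (h 0 0 * h 1 1 - h 0 1 * h 1 0) = 1)
    (hlow : valuation F (h 1 0) ≤ uniformizer F ^ d) : ProjGenLinGroup.mk h ∈ Gamma F d := by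
  let M : Matrix (Fin 2) (Fin 2) 𝒪[F] := Matrix.of fun i j => ⟨h i j, hint i j⟩
  have hM : IsUnit M.det := by
    rw [(Valuation.integer.integers (valuation F)).isUnit_iff_valuation_eq_one, ← hdet,
      Matrix.det_fin_two]
    rfl
  exact ⟨GeneralLinearGroup.mk'' M hM, (mem_maximalIdeal_pow_iff _ _).2 hlow,
    congrArg ProjGenLinGroup.mk (Units.ext rfl)⟩

theorem exists_of_mem_Gamma {d : ℕ} {g : PGL(2, F)} (hg : g ∈ Gamma F d) :
    ∃ h : GL (Fin 2) F, ProjGenLinGroup.mk h = g ∧ (∀ i j, valuation F (h i j) ≤ 1) ∧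
      valuation F (h 0 0 * h 1 1 - h 0 1 * h 1 0) = 1 ∧
      valuation F (h 1 0) ≤ uniformizer F ^ d := by
  obtain ⟨M, hM, rfl⟩ := hg
  refine ⟨_, rfl, fun i j => (M i j).2, ?_, (mem_maximalIdeal_pow_iff _ _).1 hM⟩
  have hdet := (Valuation.integer.integers (valuation F)).valuation_unit
    (GeneralLinearGroup.det M)
  rwa [GeneralLinearGroup.val_det_apply, Matrix.det_fin_two] at hdet

theorem Gamma_anti : Antitone (Gamma F) := by
  intro m n hmn g hg
  obtain ⟨h, rfl, hint, hdet, hlow⟩ := exists_of_mem_Gamma hg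
  exact mk_mem_Gamma hint hdet (hlow.trans (uniformizer_pow_le_pow hmn))

theorem tor_mul_unip_mem_Gamma_iff {d : ℕ} {a : Fˣ} {b : F} :
    tor a * unip b ∈ Gamma F d ↔ valuation F (a : F) = 1 ∧ valuation F b ≤ 1 := by
  rw [unip_eq_mk, tor, ← map_mul, mkOfDetNeZero_mul]
  refine ⟨fun hab => ?_, fun ⟨ha, hb⟩ => mk_mem_Gamma (fun i j => ?_) ?_ ?_⟩
  · obtain ⟨h, hh, hint, hdet, -⟩ := exists_of_mem_Gamma hab
    obtain ⟨z, rfl⟩ := ProjGenLinGroup.mk_eq_mk_iff.1 hh.symm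
    have haz : valuation F (a : F) * valuation F (z : F) ≤ 1 := by
      simpa [mkOfDetNeZero_apply, Matrix.scalar_apply] using hint 0 0
    have hz : valuation F (z : F) ≤ 1 := by
      simpa [mkOfDetNeZero_apply, Matrix.scalar_apply] using hint 1 1
    have hprod : valuation F (a : F) * valuation F (z : F) * valuation F (z : F) = 1 := by
      simpa [mkOfDetNeZero_apply, Matrix.scalar_apply] using hdet
    have hz1 : valuation F (z : F) = 1 :=
      le_antisymm hz (hprod.ge.trans (mul_le_of_le_one_left' haz))
    have ha1 : valuation F (a : F) = 1 := by rwa [hz1, mul_one, mul_one] at hprod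
    refine ⟨ha1, ?_⟩
    simpa [mkOfDetNeZero_apply, Matrix.scalar_apply, hz1, ha1] using hint 0 1
  · fin_cases i <;> fin_cases j <;> simp [mkOfDetNeZero_apply, ha, hb]
  · simp [mkOfDetNeZero_apply, ha]
  · simp [mkOfDetNeZero_apply]

theorem unip_mem_Gamma_iff {d : ℕ} {b : F} : unip b ∈ Gamma F d ↔ valuation F b ≤ 1 := by
  simpa [tor_one] using tor_mul_unip_mem_Gamma_iff (d := d) (a := 1) (b := b)

theorem tor_mem_Gamma_iff {d : ℕ} {a : Fˣ} : tor a ∈ Gamma F d ↔ valuation F (a : F) = 1 := by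
  simpa [unip_zero] using tor_mul_unip_mem_Gamma_iff (d := d) (a := a) (b := 0)

theorem lowUnip_mem_Gamma {d : ℕ} {r : F} (hr : valuation F r ≤ uniformizer F ^ d) :
    lowUnip r ∈ Gamma F d := by
  refine mk_mem_Gamma (fun i j => ?_) ?_ ?_
  · fin_cases i <;> fin_cases j <;>
      simp [mkOfDetNeZero_apply, hr.trans (uniformizer_pow_le_one d)]
  · simp [mkOfDetNeZero_apply]
  · simpa [mkOfDetNeZero_apply] using hr

theorem valuation_ratio_slope_of_mem_Gamma {d : ℕ} (hd : 0 < d) {g : PGL(2, F)}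
    (hg : g ∈ Gamma F d) :
    valuation F (ratio g) = 1 ∧ valuation F (slope g) ≤ uniformizer F ^ d := by
  obtain ⟨h, rfl, hint, hdet, hlow⟩ := exists_of_mem_Gamma hg
  have hoff : valuation F (h 0 1 * h 1 0) < 1 := by
    rw [map_mul]
    exact (mul_le_of_le_one_left' (hint 0 1)).trans_lt
      (hlow.trans_lt (uniformizer_pow_lt_one hd))
  have hdiag : valuation F (h 0 0) * valuation F (h 1 1) = 1 := by
    rw [← map_mul]
    exact valuation_eq_one_of_sub_lt hdet (by rwa [sub_sub_cancel])
  have hh : valuation F (h 0 0) = 1 :=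
    le_antisymm (hint 0 0) (hdiag.ge.trans (mul_le_of_le_one_right' (hint 1 1)))
  rw [ratio_mk_eq_div, slope_mk, map_div₀, map_div₀, hdet, map_pow, hh, one_pow, div_one, div_one]
  exact ⟨rfl, hlow⟩

theorem mem_Gamma_mul_U_iff {d : ℕ} (hd : 0 < d) {g : PGL(2, F)} :
    g ∈ (Gamma F d : Set PGL(2, F)) * (U F : Set PGL(2, F)) ↔
      valuation F (ratio g) = 1 ∧ valuation F (slope g) ≤ uniformizer F ^ d := by
  constructor
  · rintro ⟨γ, hγ, _, ⟨b, rfl⟩, rfl⟩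
    simpa only [ratio_mul_unip, slope_mul_unip] using valuation_ratio_slope_of_mem_Gamma hd hγ
  · rintro ⟨hratio, hslope⟩
    obtain ⟨b, hb⟩ :=
      exists_eq_lowUnip_mul_tor_mul_unip ((valuation F).ne_zero_iff.1 (hratio ▸ one_ne_zero))
    rw [hb]
    exact Set.mul_mem_mul (mul_mem (lowUnip_mem_Gamma hslope) (tor_mem_Gamma_iff.2 hratio)) ⟨b, rfl⟩

theorem exists_eq_mul_of_mem_Gamma {d : ℕ} (hd : 0 < d) {γ : PGL(2, F)} (hγ : γ ∈ Gamma F d) :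
    ∃ (r : F) (a : Fˣ) (b : F), valuation F r ≤ uniformizer F ^ d ∧ valuation F (a : F) = 1 ∧
      valuation F b ≤ 1 ∧ γ = lowUnip r * tor a * unip b := by
  obtain ⟨hratio, hslope⟩ := valuation_ratio_slope_of_mem_Gamma hd hγ
  obtain ⟨b, hb⟩ :=
    exists_eq_lowUnip_mul_tor_mul_unip ((valuation F).ne_zero_iff.1 (hratio ▸ one_ne_zero))
  refine ⟨slope γ, _, b, hslope, hratio, (unip_mem_Gamma_iff (d := d)).1 ?_, hb⟩
  rw [hb] at hγ
  exact (Subgroup.mul_mem_cancel_left _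
    (mul_mem (lowUnip_mem_Gamma hslope) (tor_mem_Gamma_iff.2 hratio))).1 hγ

theorem exists_mul_ratio_ne_zero (g : PGL(2, F)) :
    ∃ w ∈ Gamma F 0, ratio (w * g) ≠ 0 ∧ valuation F (slope (w * g)) ≤ 1 := by
  induction g using ProjGenLinGroup.induction_on with | mk h =>
  have hcol : ¬(h 0 0 = 0 ∧ h 1 0 = 0) := fun ⟨h0, h1⟩ =>
    det_entries_ne_zero h (by rw [h0, h1, zero_mul, mul_zero, sub_zero])
  rcases le_total (valuation F (h 1 0)) (valuation F (h 0 0)) with hle | hle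
  · have h0 : h 0 0 ≠ 0 := fun h0 => hcol ⟨h0, by
      rwa [h0, map_zero, le_zero_iff, (valuation F).zero_iff] at hle⟩
    refine ⟨1, one_mem _, ?_⟩
    rw [one_mul, slope_mk, map_div₀]
    exact ⟨ratio_mk_ne_zero_iff.2 h0, div_le_one_of_le₀ hle zero_le⟩
  · have h1 : h 1 0 ≠ 0 := fun h1 => hcol ⟨by
      rwa [h1, map_zero, le_zero_iff, (valuation F).zero_iff] at hle, h1⟩
    let w : GL (Fin 2) F := GeneralLinearGroup.mkOfDetNeZero !![0, 1; 1, 0] (by simp)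
    have hw : ∀ i, (w * h) i 0 = ![h 1 0, h 0 0] i := fun i => by
      fin_cases i <;> simp [w, Matrix.mul_apply]
    refine ⟨ProjGenLinGroup.mk w, mk_mem_Gamma (fun i j => ?_) ?_ ?_, ?_⟩
    · fin_cases i <;> fin_cases j <;> simp [w, mkOfDetNeZero_apply]
    · simp [w, mkOfDetNeZero_apply]
    · simp [w, mkOfDetNeZero_apply]
    rw [← map_mul, ratio_mk_ne_zero_iff, slope_mk, hw, hw, map_div₀]
    exact ⟨h1, div_le_one_of_le₀ hle zero_le⟩

theorem exists_iwasawa (g : PGL(2, F)) :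
    ∃ k ∈ Gamma F 0, ∃ (n : ℤ) (b : F), g = k * tor (varpi F ^ n) * unip b := by
  obtain ⟨w, hw, hratio, hslope⟩ := exists_mul_ratio_ne_zero g
  obtain ⟨n, hn⟩ := exists_valuation_eq_uniformizer_zpow hratio
  obtain ⟨b, hb⟩ := exists_eq_lowUnip_mul_tor_mul_unip hratio
  have hunit : valuation F (Units.mk0 _ hratio * (varpi F ^ n)⁻¹ : Fˣ) = 1 := by
    rw [Units.val_mul, map_mul, ← _root_.zpow_neg, valuation_varpi_zpow, Units.val_mk0, hn,
      _root_.zpow_neg, mul_inv_cancel₀ (zpow_ne_zero _ uniformizer_ne_zero)]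
  refine ⟨w⁻¹ * (lowUnip (slope (w * g)) * tor (Units.mk0 _ hratio * (varpi F ^ n)⁻¹)),
    mul_mem (inv_mem hw) (mul_mem (lowUnip_mem_Gamma (by simpa using hslope))
      (tor_mem_Gamma_iff.2 hunit)), n, b, ?_⟩
  rw [mul_assoc w⁻¹, mul_assoc (lowUnip _), ← tor_mul, inv_mul_cancel_right, mul_assoc w⁻¹,
    ← hb, inv_mul_cancel_left]

end CongruenceSubgroups

section Topology

variable {F : Type*} [Field F] [TopologicalSpace F]

theorem continuous_mk : Continuous (ProjGenLinGroup.mk : GL (Fin 2) F → PGL(2, F)) :=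
  continuous_quotient_mk'

theorem continuous_entry (i j : Fin 2) : Continuous fun h : GL (Fin 2) F => h i j :=
  Units.continuous_val.matrix_elem i j

variable [IsTopologicalDivisionRing F]

theorem isOpenMap_mk : IsOpenMap (ProjGenLinGroup.mk : GL (Fin 2) F → PGL(2, F)) :=
  QuotientGroup.isOpenMap_coe (N := Subgroup.center (GL (Fin 2) F))

theorem continuous_mkOfDetNeZero {X : Type*} [TopologicalSpace X]
    {M : X → Matrix (Fin 2) (Fin 2) F} (hM : ∀ t, (M t).det ≠ 0) (hc : Continuous M) :
    Continuous fun t => GeneralLinearGroup.mkOfDetNeZero (M t) (hM t) := by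
  refine Units.continuous_iff.2 ⟨hc, ?_⟩
  have hinv (t : X) : ((GeneralLinearGroup.mkOfDetNeZero (M t) (hM t))⁻¹ : GL (Fin 2) F).1 =
      (M t).det⁻¹ • (M t).adjugate := by
    rw [GeneralLinearGroup.coe_inv, Matrix.inv_def, Ring.inverse_eq_inv']
    rfl
  simp only [hinv]
  exact (hc.matrix_det.inv₀ hM).smul hc.matrix_adjugate

theorem continuous_lowUnip : Continuous (lowUnip : F → PGL(2, F)) := by
  refine continuous_mk.comp (continuous_mkOfDetNeZero _ (continuous_matrix fun i j => ?_))
  fin_cases i <;> fin_cases j <;> simp only [Fin.zero_eta, Fin.mk_one] <;>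
    first | exact continuous_const | exact continuous_id

theorem continuous_ratio : Continuous (ratio : PGL(2, F) → F) :=
  continuous_quot_lift _ (((continuous_entry 0 0).pow 2).div
    Units.continuous_val.matrix_det fun h => h.det_ne_zero)

end Topology

section CompactOpenSubgroups

variable {F : Type*} [Field F] [ValuativeRel F] [TopologicalSpace F]
  [IsNonarchimedeanLocalField F]

theorem isOpen_Gamma (d : ℕ) : IsOpen (Gamma F d : Set PGL(2, F)) := by
  refine Subgroup.isOpen_of_mem_nhds _ (g := 1) ?_
  have hball (m : ℕ) {f : GL (Fin 2) F → F} (hf : Continuous f) :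
      ∀ᶠ h in nhds 1, valuation F (f h - f 1) ≤ uniformizer F ^ m :=
    (hf.sub continuous_const).continuousAt.eventually_mem
      ((isOpen_setOf_valuation_le (pow_ne_zero m uniformizer_ne_zero)).mem_nhds (by simp))
  have hint : ∀ᶠ h in nhds (1 : GL (Fin 2) F), ∀ i j, valuation F (h i j) ≤ 1 :=
    Filter.eventually_all.2 fun i => Filter.eventually_all.2 fun j =>
      (continuous_entry i j).continuousAt.eventually_mem
        ((isOpen_setOf_valuation_le one_ne_zero).mem_nhds
          (by fin_cases i <;> fin_cases j <;> simp))
  rw [← map_one ProjGenLinGroup.mk]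
  refine Filter.mem_of_superset (isOpenMap_mk.image_mem_nhds (hint.and
    ((hball d (continuous_entry 1 0)).and (hball 1 Units.continuous_val.matrix_det)))) ?_
  rintro _ ⟨h, ⟨hint, hlow, hdet⟩, rfl⟩
  refine mk_mem_Gamma hint (valuation_eq_one_of_sub_lt (map_one _) ?_) (by simpa using hlow)
  refine lt_of_le_of_lt ?_ (uniformizer_pow_lt_one one_pos)
  simpa [Matrix.det_fin_two] using hdet

theorem isClosed_Gamma (d : ℕ) : IsClosed (Gamma F d : Set PGL(2, F)) :=
  Subgroup.isClosed_of_isOpen _ (isOpen_Gamma d)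

theorem isCompact_Gamma_zero : IsCompact (Gamma F 0 : Set PGL(2, F)) := by
  have : CompactSpace (Matrix (Fin 2) (Fin 2) 𝒪[F]) :=
    inferInstanceAs (CompactSpace (Fin 2 → Fin 2 → 𝒪[F]))
  have : T1Space (Matrix (Fin 2) (Fin 2) 𝒪[F]) :=
    inferInstanceAs (T1Space (Fin 2 → Fin 2 → 𝒪[F]))
  have : CompactSpace (GL (Fin 2) 𝒪[F]) :=
    inferInstanceAs (CompactSpace (Matrix (Fin 2) (Fin 2) 𝒪[F])ˣ)
  have hentries : Continuous (RingHom.mapMatrix (m := Fin 2) (algebraMap 𝒪[F] F)).toMonoidHom :=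
    continuous_id.matrix_map continuous_subtype_val
  have hmap : Continuous (GeneralLinearGroup.map (n := Fin 2) (algebraMap 𝒪[F] F)) :=
    Continuous.units_map _ hentries
  have htop : GammaTilde F 0 = ⊤ := by
    refine top_unique fun g _ => ?_
    change g 1 0 ∈ 𝓂[F] ^ 0
    rw [pow_zero, Ideal.one_eq_top]
    trivial
  rw [Gamma, htop, Subgroup.coe_map, MonoidHom.coe_comp, Subgroup.coe_top, Set.image_comp]
  exact (isCompact_univ.image hmap).image continuous_mk

theorem isCompact_Gamma (d : ℕ) : IsCompact (Gamma F d : Set PGL(2, F)) :=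
  isCompact_Gamma_zero.of_isClosed_subset (isClosed_Gamma d) (Gamma_anti (Nat.zero_le d))

end CompactOpenSubgroups

section BumpFunctions

theorem isLocallyConstant_of_left_invariant {G Y : Type*} [Group G] [TopologicalSpace G]
    [ContinuousMul G] {f : G → Y} {S : Set G} (hS : S ∈ nhds 1)
    (hf : ∀ s ∈ S, ∀ g, f (s * g) = f g) : IsLocallyConstant f := by
  refine (IsLocallyConstant.iff_eventually_eq _).2 fun g => ?_
  have hg : Filter.Tendsto (fun h : G => h * g⁻¹) (nhds g) (nhds 1) := by
    simpa only [mul_inv_cancel] using (continuous_mul_const g⁻¹).tendsto g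
  filter_upwards [hg hS] with h hh
  simpa only [inv_mul_cancel_right] using hf _ hh g

variable {F : Type*} [Field F] [ValuativeRel F] [TopologicalSpace F]
  (x : 𝒪[F]ˣ →ₜ* ℂˣ)

/-- The function supported on `Γ_m U` and equal to `x̃` there. For `m = d(x)` this is `f₀`; for
larger `m` these functions isolate ever smaller neighbourhoods of `1` in `G / T(𝒪)U`. -/
def bump (m : ℕ) : PGL(2, F) → ℂ :=
  Set.indicator ((Gamma F m : Set PGL(2, F)) * (U F : Set PGL(2, F))) (tildeChar x)

variable {x} {m : ℕ}

theorem tildeChar_one : tildeChar x (1 : PGL(2, F)) = 1 := by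
  rw [tildeChar, ratio_one, extChar_one]

theorem tildeChar_lowUnip_mul_tor_mul_unip (r : F) (a : Fˣ) (b : F) :
    tildeChar x (lowUnip r * tor a * unip b) = extChar x a := by
  have h1 : ratio (1 : PGL(2, F)) ≠ 0 := by rw [ratio_one]; exact one_ne_zero
  have ha : ratio (tor a) = a := by simpa [ratio_one] using ratio_tor_mul a h1
  rw [tildeChar, ratio_mul_unip, ratio_lowUnip_mul _ (ha ▸ a.ne_zero), ha]

variable [IsNonarchimedeanLocalField F]

theorem tildeChar_mul (hx : 0 < depth x) {γ g : PGL(2, F)} (hγ : γ ∈ Gamma F (depth x))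
    (hratio : valuation F (ratio g) = 1)
    (hslope : valuation F (slope g) ≤ uniformizer F ^ depth x) :
    tildeChar x (γ * g) = tildeChar x γ * tildeChar x g := by
  obtain ⟨r, a, b, -, ha, hb, rfl⟩ := exists_eq_mul_of_mem_Gamma hx hγ
  have hbs : valuation F (1 + b * slope g - 1) ≤ uniformizer F ^ depth x := by
    rw [add_sub_cancel_left, map_mul]
    exact (mul_le_of_le_one_left' hb).trans hslope
  have hunit : valuation F (1 + b * slope g) = 1 :=
    valuation_eq_one_of_sub_lt (map_one _) (hbs.trans_lt (uniformizer_pow_lt_one hx))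
  have hg : ratio g ≠ 0 := (valuation F).ne_zero_iff.1 (hratio ▸ one_ne_zero)
  have hug : ratio (unip b * g) ≠ 0 := by
    rw [ratio_unip_mul _ hg]
    exact mul_ne_zero (pow_ne_zero _ ((valuation F).ne_zero_iff.1 (hunit ▸ one_ne_zero))) hg
  have htug : ratio (tor a * (unip b * g)) ≠ 0 := by
    rw [ratio_tor_mul _ hug]
    exact mul_ne_zero a.ne_zero hug
  rw [tildeChar_lowUnip_mul_tor_mul_unip, tildeChar, tildeChar, mul_assoc, mul_assoc,
    ratio_lowUnip_mul _ htug, ratio_tor_mul _ hug, ratio_unip_mul _ hg, extChar_mul x ha,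
    extChar_mul x (by rw [map_pow, hunit, one_pow]), extChar_sq_eq_one x hx hbs, one_mul]

theorem eventually_mem_Gamma_and_tildeChar_eq_one (hx : 0 < depth x) (m : ℕ) :
    ∀ᶠ γ : PGL(2, F) in nhds 1, γ ∈ Gamma F m ∧ tildeChar x γ = 1 := by
  refine ((isOpen_Gamma m).eventually_mem (one_mem _)).and ?_
  have hratio := (continuous_ratio (F := F)).tendsto 1
  rw [ratio_one] at hratio
  exact hratio.eventually (eventually_extChar_eq_one x hx)

theorem mul_mem_subgroup_mul_iff {G : Type*} [Group G] {H : Subgroup G} {S : Set G} {γ g : G}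
    (hγ : γ ∈ H) : γ * g ∈ (H : Set G) * S ↔ g ∈ (H : Set G) * S := by
  constructor
  · rintro ⟨h, hh, s, hs, hg⟩
    exact ⟨γ⁻¹ * h, mul_mem (inv_mem hγ) hh, s, hs,
      (mul_assoc _ _ _).trans (inv_mul_eq_iff_eq_mul.2 hg)⟩
  · rintro ⟨h, hh, s, hs, rfl⟩
    exact ⟨γ * h, mul_mem hγ hh, s, hs, mul_assoc _ _ _⟩

theorem bump_mul_left (hx : 0 < depth x) (hm : depth x ≤ m) {γ : PGL(2, F)}
    (hγ : γ ∈ Gamma F m) (g : PGL(2, F)) : bump x m (γ * g) = tildeChar x γ * bump x m g := by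
  by_cases hg : g ∈ (Gamma F m : Set PGL(2, F)) * (U F : Set PGL(2, F))
  · obtain ⟨hratio, hslope⟩ := (mem_Gamma_mul_U_iff (hx.trans_le hm)).1 hg
    rw [bump, Set.indicator_of_mem hg, Set.indicator_of_mem ((mul_mem_subgroup_mul_iff hγ).2 hg),
      tildeChar_mul hx (Gamma_anti hm hγ) hratio (hslope.trans (uniformizer_pow_le_pow hm))]
  · rw [bump, Set.indicator_of_notMem hg,
      Set.indicator_of_notMem (mt (mul_mem_subgroup_mul_iff hγ).1 hg), mul_zero]

theorem bump_eq_indicator_slope (hm : 0 < m) :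
    bump x m = Set.indicator {g | valuation F (slope g) ≤ uniformizer F ^ m} (tildeChar x) := by
  have hset : (Gamma F m : Set PGL(2, F)) * (U F : Set PGL(2, F)) =
      {g | valuation F (slope g) ≤ uniformizer F ^ m} ∩ Function.support (tildeChar x) := by
    ext g
    rw [mem_Gamma_mul_U_iff hm, and_comm]
    exact and_congr_right' ⟨extChar_ne_zero x, valuation_eq_one_of_extChar_ne_zero⟩
  rw [bump, hset, Set.indicator_inter_support]

theorem bump_mul_unip (hm : 0 < m) (g : PGL(2, F)) (b : F) :
    bump x m (g * unip b) = bump x m g := by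
  simp only [bump_eq_indicator_slope hm, Set.indicator_apply, Set.mem_ofPred_eq, tildeChar,
    slope_mul_unip, ratio_mul_unip]

theorem bump_mul_tor (hm : 0 < m) (g : PGL(2, F)) {a : Fˣ} (ha : valuation F (a : F) = 1) :
    bump x m (g * tor a) = extChar x a * bump x m g := by
  simp only [bump_eq_indicator_slope hm, Set.indicator_apply, Set.mem_ofPred_eq, tildeChar,
    slope_mul_tor, ratio_mul_tor, extChar_mul x ha, mul_ite, mul_zero]

theorem bump_mem_V (hx : 0 < depth x) (hm : depth x ≤ m) : bump x m ∈ V x := by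
  refine ⟨isLocallyConstant_of_left_invariant
    (eventually_mem_Gamma_and_tildeChar_eq_one hx m) ?_,
    ⟨_, isCompact_Gamma m, Set.support_indicator_subset⟩, ?_⟩
  · rintro γ ⟨hγ, hγ1⟩ g
    rw [bump_mul_left hx hm hγ, hγ1, one_mul]
  · rintro g a _ ⟨b, rfl⟩
    rw [bump_mul_unip (hx.trans_le hm), bump_mul_tor (hx.trans_le hm) _ (valuation_coe_units a)]
    exact congrArg (· * _) (extChar_coe x a)

theorem phi0_mul_left (hx : 0 < depth x) {γ : PGL(2, F)} (hγ : γ ∈ Gamma F (depth x))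
    (g : PGL(2, F)) : phi0 x (γ * g) = tildeChar x γ * phi0 x g := by
  by_cases hg : g ∈ Gamma F (depth x)
  · obtain ⟨hratio, hslope⟩ := valuation_ratio_slope_of_mem_Gamma hx hg
    rw [phi0, Set.indicator_of_mem (SetLike.mem_coe.2 hg),
      Set.indicator_of_mem (SetLike.mem_coe.2 (mul_mem hγ hg)), tildeChar_mul hx hγ hratio hslope]
  · rw [phi0, Set.indicator_of_notMem (mt SetLike.mem_coe.1 hg), Set.indicator_of_notMem, mul_zero]
    rwa [SetLike.mem_coe, Subgroup.mul_mem_cancel_left _ hγ]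

theorem phi0_mul_right (hx : 0 < depth x) {γ : PGL(2, F)} (hγ : γ ∈ Gamma F (depth x))
    (g : PGL(2, F)) : phi0 x (g * γ) = tildeChar x γ * phi0 x g := by
  by_cases hg : g ∈ Gamma F (depth x)
  · rw [phi0_mul_left hx hg, mul_comm, phi0, Set.indicator_of_mem (SetLike.mem_coe.2 hγ),
      Set.indicator_of_mem (SetLike.mem_coe.2 hg)]
  · rw [phi0, Set.indicator_of_notMem (mt SetLike.mem_coe.1 hg), Set.indicator_of_notMem, mul_zero]
    rwa [SetLike.mem_coe, Subgroup.mul_mem_cancel_right _ hγ]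

theorem phi0_mem_W (hx : 0 < depth x) : phi0 x ∈ W x := by
  refine ⟨isLocallyConstant_of_left_invariant
    (eventually_mem_Gamma_and_tildeChar_eq_one hx (depth x)) ?_,
    HasCompactSupport.intro' (isCompact_Gamma _) (isClosed_Gamma _)
      fun g hg => Set.indicator_of_notMem hg _, fun g γ hγ => phi0_mul_right hx hγ g⟩
  rintro γ ⟨hγ, hγ1⟩ g
  rw [phi0_mul_left hx hγ, hγ1, one_mul]

end BumpFunctions

section AveragingBumps

variable {F : Type*} [Field F] [ValuativeRel F] [TopologicalSpace F]
  [IsNonarchimedeanLocalField F]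

theorem sum_residue_affine [Fintype 𝓀[F]] {s : 𝓀[F] → 𝒪[F]}
    (hs : ∀ c, IsLocalRing.residue 𝒪[F] (s c) = c) {ψ : 𝒪[F] → ℂ}
    (hψ : ∀ b b', b - b' ∈ 𝓂[F] → ψ b = ψ b') (u : 𝒪[F]ˣ) (e : 𝒪[F]) :
    ∑ c, ψ (u * s c + e) = ∑ c, ψ (s c) := by
  have hu : IsLocalRing.residue 𝒪[F] u ≠ 0 := (IsLocalRing.residue_ne_zero_iff_isUnit _).2 u.isUnit
  refine Fintype.sum_equiv ((Equiv.mulLeft₀ _ hu).trans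
    (Equiv.addRight (IsLocalRing.residue 𝒪[F] e))) _ _ fun c => hψ _ _ ?_
  rw [← IsLocalRing.residue_eq_zero_iff, map_sub, hs, map_add, map_mul, hs]
  exact sub_self _

variable {x : 𝒪[F]ˣ →ₜ* ℂˣ} {m : ℕ}

theorem bump_ne_zero_iff (hm : 0 < m) {g : PGL(2, F)} : bump x m g ≠ 0 ↔
    valuation F (ratio g) = 1 ∧ valuation F (slope g) ≤ uniformizer F ^ m := by
  rw [← mem_Gamma_mul_U_iff hm, bump, Set.indicator_apply_ne_zero]
  exact ⟨And.left, fun h => ⟨h, extChar_ne_zero x ((mem_Gamma_mul_U_iff hm).1 h).1⟩⟩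

theorem bump_of_slope_le (hm : 0 < m) {g : PGL(2, F)}
    (hslope : valuation F (slope g) ≤ uniformizer F ^ m) :
    bump x m g = extChar x (ratio g) := by
  rw [bump_eq_indicator_slope hm]
  exact Set.indicator_of_mem (s := {g | valuation F (slope g) ≤ uniformizer F ^ m}) hslope _

theorem bump_unip_mul_eq_extChar (hm : 0 < m) {g : PGL(2, F)} (hratio : valuation F (ratio g) = 1)
    (hslope : valuation F (slope g) ≤ uniformizer F ^ m) (b : F) :
    bump x m (unip b * g) = extChar x ((1 + b * slope g) ^ 2 * ratio g) := by
  have hg : ratio g ≠ 0 := (valuation F).ne_zero_iff.1 (hratio ▸ one_ne_zero)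
  by_cases hunit : valuation F (1 + b * slope g) = 1
  · rw [bump_of_slope_le hm, ratio_unip_mul _ hg]
    rwa [slope_unip_mul _ hg, map_div₀, hunit, div_one]
  · have hne : valuation F ((1 + b * slope g) ^ 2 * ratio g) ≠ 1 := by
      rw [map_mul, hratio, mul_one, map_pow]
      exact fun h => hunit ((pow_eq_one_iff_of_nonneg zero_le two_ne_zero).1 h)
    rw [extChar_eq_zero x hne, ← not_ne_iff, bump_ne_zero_iff hm, ratio_unip_mul _ hg]
    exact fun h => hne h.1

theorem bump_unip_mul_of_ne_zero (hx : 0 < depth x) (hm : 0 < m) {g : PGL(2, F)} {b : F}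
    (hb : valuation F b * uniformizer F ^ m ≤ uniformizer F ^ depth x) (hg : bump x m g ≠ 0) :
    bump x m (unip b * g) = bump x m g := by
  obtain ⟨hratio, hslope⟩ := (bump_ne_zero_iff hm).1 hg
  have hbs : valuation F (1 + b * slope g - 1) ≤ uniformizer F ^ depth x := by
    rw [add_sub_cancel_left, map_mul]
    exact (mul_le_mul_right hslope _).trans hb
  have hunit : valuation F (1 + b * slope g) = 1 :=
    valuation_eq_one_of_sub_lt (map_one _) (hbs.trans_lt (uniformizer_pow_lt_one hx))
  rw [bump_unip_mul_eq_extChar hm hratio hslope, extChar_mul x (by rw [map_pow, hunit, one_pow]),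
    extChar_sq_eq_one x hx hbs, one_mul, bump_of_slope_le hm hslope]

theorem bump_unip_mul (hx : 0 < depth x) (hm : 0 < m) {b : F}
    (hb : valuation F b * uniformizer F ^ m ≤ uniformizer F ^ depth x) (g : PGL(2, F)) :
    bump x m (unip b * g) = bump x m g := by
  by_cases hg : bump x m g = 0
  · by_contra hne
    have hcancel : unip (-b) * (unip b * g) = g := by
      rw [← mul_assoc, ← unip_add, neg_add_cancel, unip_zero, one_mul]
    have h := bump_unip_mul_of_ne_zero hx hm (b := -b) (by rwa [Valuation.map_neg])
      fun h => hne (h.trans hg.symm)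
    exact hne (by rw [← h, hcancel])
  · exact bump_unip_mul_of_ne_zero hx hm hb hg

section Sum

variable {κ : F}

theorem bump_unip_mul_congr (hx : 0 < depth x) (hm : 0 < m)
    (hκ : valuation F κ * uniformizer F ^ (m + 1) ≤ uniformizer F ^ depth x) (g : PGL(2, F))
    {b b' : 𝒪[F]} (hb : b - b' ∈ 𝓂[F]) :
    bump x m (unip (κ * b) * g) = bump x m (unip (κ * b') * g) := by
  have hsub : unip (κ * b) * g = unip (κ * (b - b' : 𝒪[F])) * (unip (κ * b') * g) := by
    rw [← mul_assoc, ← unip_add, ← mul_add, AddSubgroupClass.coe_sub, sub_add_cancel]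
  have hval : valuation F (b - b' : 𝒪[F]) ≤ uniformizer F := by
    simpa only [pow_one] using (mem_maximalIdeal_pow_iff (b - b') 1).1 (by rwa [pow_one])
  rw [hsub, bump_unip_mul hx hm]
  rw [map_mul, mul_assoc]
  refine le_trans ?_ hκ
  rw [pow_succ']
  gcongr

variable [Fintype 𝓀[F]] {s : 𝓀[F] → 𝒪[F]}

theorem sum_bump_unip_mul_unip_mul (hx : 0 < depth x) (hm : 0 < m)
    (hs : ∀ c, IsLocalRing.residue 𝒪[F] (s c) = c)
    (hκ : valuation F κ * uniformizer F ^ (m + 1) ≤ uniformizer F ^ depth x) (g : PGL(2, F))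
    (e : 𝒪[F]) :
    ∑ c, bump x m (unip (κ * s c) * (unip (κ * e) * g)) = ∑ c, bump x m (unip (κ * s c) * g) := by
  have h := sum_residue_affine hs
    (fun _ _ => bump_unip_mul_congr (x := x) hx hm hκ g) 1 e
  simpa only [Units.val_one, one_mul, Subring.coe_add, mul_add, unip_add, mul_assoc] using h

/- For `z = 1 + κ σ e` with `x (z ^ 2) ≠ 1`, the substitution `b ↦ z b + e` multiplies
`x ((1 + κ b σ) ^ 2)` by `x (z ^ 2)`. -/
theorem sum_bump_unip_mul_eq_zero (hx : 0 < depth x) (hm : 0 < m)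
    (hs : ∀ c, IsLocalRing.residue 𝒪[F] (s c) = c)
    (hκ : valuation F κ * uniformizer F ^ (m + 1) = uniformizer F ^ depth x) {g : PGL(2, F)}
    (hratio : valuation F (ratio g) = 1) (hslope : valuation F (slope g) = uniformizer F ^ m) :
    ∑ c, bump x m (unip (κ * s c) * g) = 0 := by
  obtain ⟨z, hz, hz1, hxz⟩ := exists_extChar_sq_ne_one x hx
  obtain ⟨u, rfl⟩ := exists_units_coe_eq hz1
  have hκσ : valuation F (κ * slope g) = uniformizer F ^ (depth x - 1) := by
    refine mul_right_cancel₀ (uniformizer_ne_zero (R := F)) ?_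
    rw [map_mul, hslope, mul_assoc, ← pow_succ, hκ, ← pow_succ, Nat.sub_add_cancel hx]
  have hκσ_ne : κ * slope g ≠ 0 :=
    (valuation F).ne_zero_iff.1 (hκσ ▸ pow_ne_zero _ uniformizer_ne_zero)
  let e : 𝒪[F] := ⟨((u : 𝒪[F]) - 1) / (κ * slope g), by
    rw [Valuation.mem_integer_iff, map_div₀, hκσ]
    exact div_le_one_of_le₀ hz zero_le⟩
  have hsubst (b : 𝒪[F]) : bump x m (unip (κ * (u * b + e : 𝒪[F])) * g) =
      extChar x ((u : 𝒪[F]) ^ 2 : F) * bump x m (unip (κ * b) * g) := by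
    have hfactor : 1 + κ * (u * b + e : 𝒪[F]) * slope g = u * (1 + κ * b * slope g) := by
      have he : (e : F) * (κ * slope g) = (u : 𝒪[F]) - 1 := div_mul_cancel₀ _ hκσ_ne
      push_cast
      linear_combination he
    rw [bump_unip_mul_eq_extChar hm hratio hslope.le, bump_unip_mul_eq_extChar hm hratio hslope.le,
      hfactor, mul_pow, mul_assoc, extChar_mul x (by rw [map_pow, hz1, one_pow])]
  have hsum := sum_residue_affine hs (fun _ _ => bump_unip_mul_congr (x := x) hx hm hκ.le g) u e
  simp only [hsubst, ← Finset.mul_sum] at hsum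
  exact by_contra fun h => hxz ((mul_eq_right₀ h).1 hsum)

theorem sum_bump_unip_mul_of_mem (hx : 0 < depth x) (hm : 0 < m)
    (hs : ∀ c, IsLocalRing.residue 𝒪[F] (s c) = c)
    (hκ : valuation F κ * uniformizer F ^ (m + 1) = uniformizer F ^ depth x) {g : PGL(2, F)}
    (hratio : valuation F (ratio g) = 1) (hslope : valuation F (slope g) ≤ uniformizer F ^ m) :
    ∑ c, bump x m (unip (κ * s c) * g) = Fintype.card 𝓀[F] * bump x (m + 1) g := by
  by_cases hsucc : valuation F (slope g) ≤ uniformizer F ^ (m + 1)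
  · have hterm (c : 𝓀[F]) : bump x m (unip (κ * s c) * g) = bump x (m + 1) g := by
      have hm' : 0 < m + 1 := m.succ_pos
      rw [← bump_unip_mul hx hm' (b := κ * s c) _ g, bump_unip_mul_eq_extChar hm hratio hslope,
        bump_unip_mul_eq_extChar hm' hratio hsucc]
      rw [← hκ, map_mul]
      gcongr
      exact mul_le_of_le_one_right' (s c).2
    rw [Finset.sum_congr rfl fun c _ => hterm c, Finset.sum_const, Finset.card_univ, nsmul_eq_mul]
  · rw [sum_bump_unip_mul_eq_zero hx hm hs hκ hratio
      (valuation_eq_uniformizer_pow hslope hsucc),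
      not_not.1 fun h => hsucc ((bump_ne_zero_iff m.succ_pos).1 h).2, mul_zero]

theorem sum_bump_unip_mul (hx : 0 < depth x) (hm : 0 < m)
    (hs : ∀ c, IsLocalRing.residue 𝒪[F] (s c) = c)
    (hκ : valuation F κ * uniformizer F ^ (m + 1) = uniformizer F ^ depth x) (g : PGL(2, F)) :
    ∑ c, bump x m (unip (κ * s c) * g) = Fintype.card 𝓀[F] * bump x (m + 1) g := by
  have hinv (b : 𝒪[F]) : bump x (m + 1) (unip (κ * b) * g) = bump x (m + 1) g := by
    refine bump_unip_mul hx m.succ_pos ?_ g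
    rw [← hκ, map_mul]
    gcongr
    exact mul_le_of_le_one_right' b.2
  by_cases hc : ∃ b : 𝒪[F], bump x m (unip (κ * b) * g) ≠ 0
  · obtain ⟨b, hb⟩ := hc
    obtain ⟨hratio, hslope⟩ := (bump_ne_zero_iff hm).1 hb
    rw [← hinv b, ← sum_bump_unip_mul_of_mem hx hm hs hκ hratio hslope,
      sum_bump_unip_mul_unip_mul hx hm hs hκ.le]
  · push Not at hc
    have hg : bump x m g = 0 := by
      simpa only [ZeroMemClass.coe_zero, mul_zero, unip_zero, one_mul] using hc 0
    have hg' : bump x (m + 1) g = 0 := by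
      by_contra hne
      obtain ⟨hratio, hslope⟩ := (bump_ne_zero_iff m.succ_pos).1 hne
      exact (bump_ne_zero_iff hm).2
        ⟨hratio, hslope.trans (uniformizer_pow_le_pow m.le_succ)⟩ hg
    rw [Finset.sum_eq_zero fun c _ => hc _, hg', mul_zero]

end Sum

theorem bump_succ_mem_generatedBy (hx : 0 < depth x) (hm : depth x ≤ m) :
    bump x (m + 1) ∈ generatedBy (leftShift PGL(2, F)) (bump x m) := by
  let _ : Fintype 𝓀[F] := Fintype.ofFinite _
  choose s hs using IsLocalRing.residue_surjective (R := 𝒪[F])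
  let κ : F := (varpi F ^ ((depth x : ℤ) - (m + 1 : ℕ)) : Fˣ)
  have hκ : valuation F κ * uniformizer F ^ (m + 1) = uniformizer F ^ depth x := by
    rw [valuation_varpi_zpow, ← zpow_natCast, ← zpow_add₀ uniformizer_ne_zero, sub_add_cancel,
      zpow_natCast]
  have hsum : bump x (m + 1) = (Fintype.card 𝓀[F] : ℂ)⁻¹ •
      ∑ c, leftShift PGL(2, F) (unip (κ * s c))⁻¹ (bump x m) := by
    ext g
    simp only [Pi.smul_apply, Finset.sum_apply, leftShift_apply, inv_inv, smul_eq_mul]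
    rw [sum_bump_unip_mul hx (hx.trans_le hm) hs hκ,
      inv_mul_cancel_left₀ (Nat.cast_ne_zero.2 Fintype.card_ne_zero)]
  rw [hsum]
  exact Submodule.smul_mem _ _ (Submodule.sum_mem _ fun c _ => Submodule.subset_span ⟨_, rfl⟩)

theorem bump_mem_generatedBy_f0 (hx : 0 < depth x) (hm : depth x ≤ m) :
    bump x m ∈ generatedBy (leftShift PGL(2, F)) (f0 x) := by
  induction m, hm using Nat.le_induction with
  | base => exact mem_generatedBy_self
  | succ m hm ih => exact generatedBy_le ih (bump_succ_mem_generatedBy hx hm)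

end AveragingBumps

section CosetDecomposition

variable {G : Type*} [Group G]

theorem eq_sum_leftShift_indicator (H : Subgroup G) {χ φ : G → ℂ}
    (hφ : ∀ g, ∀ γ ∈ H, φ (g * γ) = χ γ * φ g) (S : Finset (G ⧸ H))
    (hS : ∀ g, φ g ≠ 0 → (g : G ⧸ H) ∈ S) :
    φ = ∑ c ∈ S, φ c.out • leftShift G c.out (Set.indicator (H : Set G) χ) := by
  ext g
  have hother (c : G ⧸ H) (hc : c ≠ g) :
      (φ c.out • leftShift G c.out (Set.indicator (H : Set G) χ)) g = 0 := by
    rw [Pi.smul_apply, leftShift_apply, Set.indicator_of_notMem, smul_zero]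
    rw [SetLike.mem_coe, ← QuotientGroup.eq, QuotientGroup.out_eq']
    exact hc
  have hout : (g : G ⧸ H).out⁻¹ * g ∈ H := by rw [← QuotientGroup.eq, QuotientGroup.out_eq']
  have hself : (φ (g : G ⧸ H).out • leftShift G (g : G ⧸ H).out
      (Set.indicator (H : Set G) χ)) g = φ g := by
    rw [Pi.smul_apply, leftShift_apply, Set.indicator_of_mem hout, smul_eq_mul, mul_comm,
      ← hφ _ _ hout, mul_inv_cancel_left]
  rw [Finset.sum_apply, ← hself]
  refine (Finset.sum_eq_single _ (fun c _ => hother c) fun hg => ?_).symm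
  rw [hself]
  exact not_not.1 (mt (hS g) hg)

theorem finite_image_mk_of_isCompact [TopologicalSpace G] [IsTopologicalGroup G] {H : Subgroup G}
    (hH : IsOpen (H : Set G)) {C : Set G} (hC : IsCompact C) :
    ((QuotientGroup.mk : G → G ⧸ H) '' C).Finite := by
  have := QuotientGroup.discreteTopology hH
  exact (hC.image QuotientGroup.continuous_mk).finite_of_discrete

end CosetDecomposition

section Generation

variable {F : Type*} [Field F] [ValuativeRel F] [TopologicalSpace F]
  [IsNonarchimedeanLocalField F] {x : 𝒪[F]ˣ →ₜ* ℂˣ}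

theorem W_le_generatedBy_phi0 : W x ≤ generatedBy (leftShift PGL(2, F)) (phi0 x) := by
  rintro φ ⟨-, hcompact, hφ⟩
  have hfin := finite_image_mk_of_isCompact (isOpen_Gamma (F := F) (depth x)) hcompact
  rw [eq_sum_leftShift_indicator _ hφ hfin.toFinset fun g hg =>
    hfin.mem_toFinset.2 ⟨g, subset_tsupport _ hg, rfl⟩]
  exact Submodule.sum_mem _ fun c _ => Submodule.smul_mem _ _ (Submodule.subset_span ⟨c.out, rfl⟩)

theorem apply_mul_tor_mul_unip {f : PGL(2, F) → ℂ} (hf : f ∈ V x) (g : PGL(2, F)) {a : Fˣ}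
    (ha : valuation F (a : F) = 1) (b : F) :
    f (g * tor a * unip b) = extChar x a * f g := by
  obtain ⟨u, hu⟩ := exists_units_coe_eq ha
  obtain rfl : Units.map (algebraMap 𝒪[F] F).toMonoidHom u = a := Units.ext hu
  rw [hf.2.2 g u _ ⟨b, rfl⟩]
  exact congrArg (· * f g) (extChar_coe x u).symm

theorem apply_mul_unip {f : PGL(2, F) → ℂ} (hf : f ∈ V x) (g : PGL(2, F)) (b : F) :
    f (g * unip b) = f g := by
  simpa only [tor_one, mul_one, Units.val_one, extChar_one, one_mul] using
    apply_mul_tor_mul_unip hf g (a := 1) (by rw [Units.val_one, map_one]) b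

theorem exists_apply_mul_lowUnip_mul_tor {f : PGL(2, F) → ℂ} (hf : IsLocallyConstant f) (a : Fˣ) :
    ∃ M : ℕ, ∀ r : F, valuation F r ≤ uniformizer F ^ M →
      ∀ k ∈ Gamma F 0, f (k * lowUnip r * tor a) = f (k * tor a) := by
  refine exists_uniformizer_pow_of_eventually
    (isCompact_Gamma_zero.eventually_forall_of_forall_eventually fun k _ => ?_)
  have hleft : Continuous fun p : F × PGL(2, F) => p.2 * lowUnip p.1 * tor a :=
    (continuous_snd.mul (continuous_lowUnip.comp continuous_fst)).mul continuous_const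
  have hright : Continuous fun p : F × PGL(2, F) => p.2 * tor a :=
    continuous_snd.mul continuous_const
  filter_upwards [(hf.comp_continuous hleft).eventually_eq (0, k),
    (hf.comp_continuous hright).eventually_eq (0, k)] with p hp hp'
  simp only [Function.comp_apply, lowUnip_zero, mul_one] at hp hp'
  rw [hp, hp']

theorem exists_indicator_apply_mul_tor {f : PGL(2, F) → ℂ} (hf : f ∈ V x) (a : Fˣ) :
    ∃ M : ℕ, ∀ m, M ≤ m → ∀ k, ∀ γ ∈ Gamma F m,
      Set.indicator (Gamma F 0 : Set PGL(2, F)) (fun k => f (k * tor a)) (k * γ) =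
        tildeChar x γ *
          Set.indicator (Gamma F 0 : Set PGL(2, F)) (fun k => f (k * tor a)) k := by
  obtain ⟨M, hM⟩ := exists_apply_mul_lowUnip_mul_tor hf.1 a
  refine ⟨max M 1, fun m hm k γ hγ => ?_⟩
  have hmem := (Gamma F 0).mul_mem_cancel_right (y := k) (Gamma_anti (Nat.zero_le m) hγ)
  by_cases hk : k ∈ Gamma F 0
  swap
  · rw [Set.indicator_of_notMem hk, Set.indicator_of_notMem (mt hmem.1 hk), mul_zero]
  rw [Set.indicator_of_mem (SetLike.mem_coe.2 hk),
    Set.indicator_of_mem (SetLike.mem_coe.2 (hmem.2 hk))]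
  obtain ⟨r, t, b, hr, ht, -, rfl⟩ := exists_eq_mul_of_mem_Gamma (by lia) hγ
  have hcomm : k * (lowUnip r * tor t * unip b) * tor a =
      k * lowUnip r * tor a * tor t * unip ((a : F)⁻¹ * b) := by
    rw [mul_assoc _ (tor a) (tor t), ← tor_mul, mul_comm a t, tor_mul]
    simp only [mul_assoc, unip_mul_tor]
  rw [hcomm, apply_mul_tor_mul_unip hf _ ht, tildeChar_lowUnip_mul_tor_mul_unip,
    hM r (hr.trans (uniformizer_pow_le_pow (by lia))) k hk]

theorem valuation_eq_of_iwasawa_eq {k k' : PGL(2, F)} (hk : k ∈ Gamma F 0) (hk' : k' ∈ Gamma F 0)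
    {a a' : Fˣ} {b b' : F} (h : k * tor a * unip b = k' * tor a' * unip b') :
    valuation F (a : F) = valuation F (a' : F) := by
  have heq : k'⁻¹ * k = tor (a' * a⁻¹) * unip (((a⁻¹ : Fˣ) : F)⁻¹ * (b' - b)) := by
    rw [inv_mul_eq_iff_eq_mul, tor_mul, mul_assoc (tor a'), ← unip_mul_tor, sub_eq_add_neg,
      unip_add, ← inv_tor, ← inv_unip]
    simp only [← mul_assoc]
    rw [← h, mul_inv_cancel_right, mul_inv_cancel_right]
  have hunit := (tor_mul_unip_mem_Gamma_iff.1 (heq ▸ mul_mem (inv_mem hk') hk)).1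
  rw [Units.val_mul, Units.val_inv_eq_inv_val, map_mul, map_inv₀] at hunit
  exact (eq_of_mul_inv_eq_one hunit).symm

theorem bump_mul_tor_of_mem_Gamma_zero {m : ℕ} {k : PGL(2, F)} (hk : k ∈ Gamma F 0)
    {a : Fˣ} (ha : valuation F (a : F) ≠ 1) : bump x m (k * tor a) = 0 := by
  refine Set.indicator_of_notMem ?_ _
  rintro ⟨γ, hγ, _, ⟨b, rfl⟩, h⟩
  refine ha ?_
  rw [valuation_eq_of_iwasawa_eq hk (Gamma_anti (Nat.zero_le m) hγ) (a' := 1) (b := 0) (b' := b),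
    Units.val_one, map_one]
  rw [unip_zero, mul_one, tor_one, mul_one]
  exact h.symm

theorem bump_of_mem_Gamma_zero {m : ℕ} {k : PGL(2, F)} (hk : k ∈ Gamma F 0) :
    bump x m k = Set.indicator (Gamma F m : Set PGL(2, F)) (tildeChar x) k := by
  have hmem : k ∈ (Gamma F m : Set PGL(2, F)) * (U F : Set PGL(2, F)) ↔ k ∈ Gamma F m := by
    refine ⟨?_, fun h => ⟨k, h, 1, one_mem _, mul_one k⟩⟩
    rintro ⟨γ, hγ, _, ⟨b, rfl⟩, rfl⟩
    rw [SetLike.mem_coe] at hγ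
    refine mul_mem hγ (unip_mem_Gamma_iff.2 ((unip_mem_Gamma_iff (d := 0)).1 ?_))
    rwa [Subgroup.mul_mem_cancel_left _ (Gamma_anti (Nat.zero_le m) hγ)] at hk
  by_cases h : k ∈ Gamma F m
  · rw [bump, Set.indicator_of_mem (hmem.2 h), Set.indicator_of_mem (SetLike.mem_coe.2 h)]
  · rw [bump, Set.indicator_of_notMem (mt hmem.1 h),
      Set.indicator_of_notMem (mt SetLike.mem_coe.1 h)]

theorem leftShift_tor_varpi_bump {m m' : ℕ} {n : ℤ} (hm : 0 < m) (hm' : 0 < m')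
    (hmm' : (m' : ℤ) = m + n) :
    leftShift PGL(2, F) (tor (varpi F ^ n)) (bump x m') =
      fun g => bump x m (g * tor (varpi F ^ n)⁻¹) := by
  ext g
  rw [leftShift_apply, inv_tor]
  simp only [bump_eq_indicator_slope hm, bump_eq_indicator_slope hm', Set.indicator_apply,
    Set.mem_ofPred_eq, tildeChar, slope_mul_tor, ratio_mul_tor]
  by_cases hg : ratio g = 0
  · have hratio : ratio (tor (varpi F ^ n)⁻¹ * g) = 0 := by
      by_contra h
      refine h ?_
      have := ratio_tor_mul (varpi F ^ n) h
      rw [← inv_tor, mul_inv_cancel_left, hg, inv_tor] at this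
      exact (mul_eq_zero.1 this.symm).resolve_left (Units.ne_zero _)
    simp only [hg, hratio, mul_zero, extChar_eq_zero x (a := 0) (by simp), ite_self]
  have hvaluation : valuation F (slope (tor (varpi F ^ n)⁻¹ * g)) ≤ uniformizer F ^ m' ↔
      valuation F (slope g) ≤ uniformizer F ^ m := by
    rw [slope_tor_mul _ hg, Units.val_inv_eq_inv_val, inv_inv, map_mul, valuation_varpi_zpow,
      ← zpow_natCast, hmm', add_comm, zpow_add₀ uniformizer_ne_zero, zpow_natCast,
      mul_le_mul_iff_right₀ (zpow_pos (zero_lt_iff.2 uniformizer_ne_zero) n)]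
  simp only [hvaluation, ratio_tor_mul _ hg]

theorem bump_mul_of_iwasawa {m : ℕ} (hm : 0 < m) {k : PGL(2, F)} (hk : k ∈ Gamma F 0)
    (n₀ n : ℤ) (b : F) :
    bump x m (k * tor (varpi F ^ n₀) * unip b * tor (varpi F ^ n)⁻¹) =
      if n₀ = n then Set.indicator (Gamma F m : Set PGL(2, F)) (tildeChar x) k else 0 := by
  rw [mul_assoc _ (unip b), unip_mul_tor, ← mul_assoc, mul_assoc k, ← tor_mul, bump_mul_unip hm]
  split_ifs with h
  · rw [h, mul_inv_cancel, tor_one, mul_one, bump_of_mem_Gamma_zero hk]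
  · refine bump_mul_tor_of_mem_Gamma_zero hk fun hval => h ?_
    rw [← _root_.zpow_sub, ← map_one (valuation F), ← Units.val_one, ← zpow_zero (varpi F)] at hval
    exact sub_eq_zero.1 (valuation_varpi_zpow_injective hval)

theorem exists_mem_generatedBy_apply_iwasawa (hx : 0 < depth x) {f : PGL(2, F) → ℂ}
    (hf : f ∈ V x) (n : ℤ) :
    ∃ p ∈ generatedBy (leftShift PGL(2, F)) (f0 x), ∀ k ∈ Gamma F 0, ∀ n₀ b,
      p (k * tor (varpi F ^ n₀) * unip b) = if n₀ = n then f (k * tor (varpi F ^ n)) else 0 := by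
  obtain ⟨M, hM⟩ := exists_indicator_apply_mul_tor hf (varpi F ^ n)
  obtain ⟨m, m', hm, hm', hmm', hMm⟩ :
      ∃ m m' : ℕ, depth x ≤ m ∧ depth x ≤ m' ∧ (m' : ℤ) = m + n ∧ M ≤ m :=
    ⟨M + depth x + n.natAbs, (M + depth x + n.natAbs + n).toNat, by lia, by lia, by lia, by lia⟩
  let φ : PGL(2, F) → ℂ :=
    Set.indicator (Gamma F 0 : Set PGL(2, F)) fun k => f (k * tor (varpi F ^ n))
  have hfin := finite_image_mk_of_isCompact (isOpen_Gamma (F := F) m) isCompact_Gamma_zero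
  have hsum := eq_sum_leftShift_indicator (φ := φ) _ (hM m hMm) hfin.toFinset fun g hg =>
    hfin.mem_toFinset.2 ⟨g, Set.mem_of_indicator_ne_zero hg, rfl⟩
  refine ⟨∑ c ∈ hfin.toFinset, φ c.out • leftShift PGL(2, F) c.out
    (leftShift PGL(2, F) (tor (varpi F ^ n)) (bump x m')),
    Submodule.sum_mem _ fun c _ => Submodule.smul_mem _ _
      (Subrepresentation.apply_mem_toSubmodule _ _
        (Subrepresentation.apply_mem_toSubmodule _ _ (bump_mem_generatedBy_f0 hx hm'))),
    fun k hk n₀ b => ?_⟩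
  have hk' : f (k * tor (varpi F ^ n)) = φ k :=
    (Set.indicator_of_mem (SetLike.mem_coe.2 hk) fun k => f (k * tor (varpi F ^ n))).symm
  rw [hk', congrFun hsum k, leftShift_tor_varpi_bump (hx.trans_le hm) (hx.trans_le hm') hmm',
    Finset.sum_apply, Finset.sum_apply, Finset.ite_sum_zero]
  refine Finset.sum_congr rfl fun c _ => ?_
  by_cases hc : c.out ∈ Gamma F 0
  · simp only [Pi.smul_apply, leftShift_apply, ← mul_assoc,
      bump_mul_of_iwasawa (hx.trans_le hm) (mul_mem (inv_mem hc) hk), smul_ite, smul_zero]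
  · have hφc : φ c.out = 0 := Set.indicator_of_notMem hc _
    simp only [hφc, zero_smul, Pi.zero_apply, ite_self]

theorem exists_finset_iwasawa_exponents {f : PGL(2, F) → ℂ} (hf : f ∈ V x) :
    ∃ N : Finset ℤ, ∀ k ∈ Gamma F 0, ∀ n, f (k * tor (varpi F ^ n)) ≠ 0 → n ∈ N := by
  obtain ⟨C, hC, hsupp⟩ := hf.2.1
  obtain ⟨N, hN⟩ := hC.elim_finite_subcover
    (fun n : ℤ => (Gamma F 0 : Set PGL(2, F)) * (tor (varpi F ^ n) • (U F : Set PGL(2, F))))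
    (fun n => (isOpen_Gamma 0).mul_right) fun g _ => by
      obtain ⟨k, hk, n, b, rfl⟩ := exists_iwasawa g
      exact Set.mem_iUnion.2 ⟨n, k, hk, _, ⟨_, ⟨b, rfl⟩, rfl⟩, (mul_assoc _ _ _).symm⟩
  refine ⟨N, fun k hk n hne => ?_⟩
  obtain ⟨c, hc, _, ⟨b, rfl⟩, hcb⟩ := hsupp hne
  obtain ⟨n', hn', k', hk', _, ⟨_, ⟨b', rfl⟩, rfl⟩, rfl⟩ := Set.mem_iUnion₂.1 (hN hc)
  have := valuation_eq_of_iwasawa_eq hk hk' (a := varpi F ^ n) (a' := varpi F ^ n') (b := 0)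
    (b' := b' + b) (by
      rw [unip_zero, mul_one, unip_add, ← mul_assoc, mul_assoc k']
      exact hcb.symm)
  exact valuation_varpi_zpow_injective this ▸ hn'

theorem V_le_generatedBy_f0 (hx : 0 < depth x) :
    V x ≤ generatedBy (leftShift PGL(2, F)) (f0 x) := by
  intro f hf
  choose p hp hpval using exists_mem_generatedBy_apply_iwasawa hx hf
  obtain ⟨N, hN⟩ := exists_finset_iwasawa_exponents hf
  have hsum : f = ∑ n ∈ N, p n := by
    ext g
    obtain ⟨k, hk, n, b, rfl⟩ := exists_iwasawa g
    rw [Finset.sum_apply, apply_mul_unip hf]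
    simp only [hpval _ k hk, Finset.sum_ite_eq]
    split_ifs with hn
    · rfl
    · exact not_not.1 (mt (hN k hk n) hn)
  exact hsum ▸ Submodule.sum_mem _ fun n _ => hp n

end Generation

section Convolution

theorem measurePreserving_mul_right_haar {G : Type*} [Group G] [TopologicalSpace G]
    [IsTopologicalGroup G] [LocallyCompactSpace G] [MeasurableSpace G] [BorelSpace G]
    {R : Subgroup G} (hRo : IsOpen (R : Set G)) (hRc : IsCompact (R : Set G)) {γ : G}
    (hγ : γ ∈ R) : MeasurePreserving (· * γ) (Measure.haar : Measure G) Measure.haar := by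
  have hmeas : Measurable (· * γ : G → G) := (continuous_mul_const γ).measurable
  have hreg : (Measure.map (· * γ) (Measure.haar : Measure G)).Regular :=
    Measure.Regular.map (Homeomorph.mulRight γ)
  have hmul := Measure.isMulLeftInvariant_eq_smul_of_regular
    (Measure.map (· * γ) (Measure.haar : Measure G)) Measure.haar
  set c := Measure.haarScalarFactor (Measure.map (· * γ) (Measure.haar : Measure G)) Measure.haar
  have hpre : (· * γ) ⁻¹' (R : Set G) = R := Set.ext fun _ => Subgroup.mul_mem_cancel_right _ hγ
  have hR : (1 : ENNReal) * Measure.haar (R : Set G) = c * Measure.haar (R : Set G) := by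
    have h := congrArg (· (R : Set G)) hmul
    rwa [Measure.map_apply hmeas hRo.measurableSet, hpre, ← one_mul (Measure.haar _)] at h
  have hc : (1 : ENNReal) = c :=
    (ENNReal.mul_left_inj (hRo.measure_pos _ ⟨1, one_mem _⟩).ne' hRc.measure_lt_top.ne).1 hR
  refine ⟨hmeas, ?_⟩
  rw [hmul, ← ENNReal.coe_inj.1 hc, one_smul]

variable {F : Type*} [Field F] [ValuativeRel F] [TopologicalSpace F]
  [IsNonarchimedeanLocalField F]

section NormalizedHaarMeasure

variable {R : Subgroup PGL(2, F)} (hRo : IsOpen (R : Set PGL(2, F)))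
  (hRc : IsCompact (R : Set PGL(2, F)))

include hRo

theorem ae_ch_mem : ∀ᵐ h ∂ch R, h ∈ R :=
  Measure.ae_smul_measure (ae_restrict_mem hRo.measurableSet) _

include hRc

theorem isProbabilityMeasure_ch : IsProbabilityMeasure (ch R) where
  measure_univ := by
    rw [ch, Measure.smul_apply, Measure.restrict_apply_univ, smul_eq_mul]
    exact ENNReal.inv_mul_cancel (hRo.measure_pos _ ⟨1, one_mem _⟩).ne' hRc.measure_lt_top.ne

theorem integral_ch_mul_right {γ : PGL(2, F)} (hγ : γ ∈ R) (f : PGL(2, F) → ℂ) :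
    ∫ h, f (h * γ) ∂ch R = ∫ h, f h ∂ch R := by
  have hpre : (· * γ) ⁻¹' (R : Set PGL(2, F)) = R :=
    Set.ext fun _ => Subgroup.mul_mem_cancel_right _ hγ
  have hpres := ((measurePreserving_mul_right_haar hRo hRc hγ).restrict_preimage
    hRo.measurableSet).smul_measure (Measure.haar (R : Set PGL(2, F)))⁻¹
  rw [hpre] at hpres
  exact hpres.integral_comp (Homeomorph.mulRight γ).measurableEmbedding f

end NormalizedHaarMeasure

variable {x : 𝒪[F]ˣ →ₜ* ℂˣ}

theorem opA_leftShift (f : PGL(2, F) → ℂ) (g : PGL(2, F)) :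
    opA x (leftShift PGL(2, F) g f) = leftShift PGL(2, F) g (opA x f) := by
  funext h
  simp only [opA, conv, leftShift_apply, mul_assoc]

theorem opA_mul_right (hx : 0 < depth x) (f : PGL(2, F) → ℂ) {γ : PGL(2, F)}
    (hγ : γ ∈ Gamma F (depth x)) (g : PGL(2, F)) :
    opA x f (g * γ) = tildeChar x γ * opA x f g := by
  rw [opA, conv, conv, ← integral_ch_mul_right (isOpen_Gamma _) (isCompact_Gamma _) hγ,
    ← integral_const_mul]
  congr 1
  funext h
  rw [phi0_mul_right hx hγ, _root_.mul_inv_rev, mul_assoc g, mul_inv_cancel_left, mul_left_comm]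

theorem opA_f0_mul_left (hx : 0 < depth x) {γ : PGL(2, F)} (hγ : γ ∈ Gamma F (depth x))
    (g : PGL(2, F)) : opA x (f0 x) (γ * g) = tildeChar x γ * opA x (f0 x) g := by
  rw [opA, conv, conv, ← integral_const_mul]
  congr 1
  funext h
  rw [mul_assoc γ, ← mul_assoc (tildeChar x γ)]
  exact congrArg (· * _) (bump_mul_left hx le_rfl hγ _)

theorem opA_f0_one (hx : 0 < depth x) : opA x (f0 x) 1 = 1 := by
  have := isProbabilityMeasure_ch (isOpen_Gamma (F := F) (depth x)) (isCompact_Gamma _)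
  have hone : ∀ᵐ h ∂ch (Gamma F (depth x)), f0 x (1 * h⁻¹) * phi0 x h = 1 := by
    filter_upwards [ae_ch_mem (isOpen_Gamma (depth x))] with h hh
    have hf0 : f0 x h⁻¹ = tildeChar x h⁻¹ := by
      simpa only [mul_one] using f0_mul x (inv_mem hh) (one_mem (U F))
    rw [one_mul, hf0, ← phi0_mul_left hx (inv_mem hh), inv_mul_cancel, phi0,
      Set.indicator_of_mem (SetLike.mem_coe.2 (one_mem _)), tildeChar_one]
  rw [opA, conv, integral_congr_ae hone, integral_const, probReal_univ, one_smul]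

theorem exists_eq_mul_unip_mul_of_opA_f0_ne_zero {g : PGL(2, F)} (hg : opA x (f0 x) g ≠ 0) :
    ∃ γ ∈ Gamma F (depth x), ∃ b, ∃ γ' ∈ Gamma F (depth x), g = γ * unip b * γ' := by
  contrapose! hg
  refine integral_eq_zero_of_ae (Filter.Eventually.of_forall fun h => mul_eq_zero.2 ?_)
  refine or_iff_not_imp_right.2 fun hh => Set.indicator_of_notMem ?_ _
  rintro ⟨γ, hγ, _, ⟨b, rfl⟩, hγb⟩
  exact hg γ hγ b h (Set.mem_of_indicator_ne_zero hh) (mul_inv_eq_iff_eq_mul.1 hγb.symm)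

theorem opA_f0_unip (hx : 0 < depth x) {b : F} (hb : 1 < valuation F b) :
    opA x (f0 x) (unip b) = 0 := by
  -- For suitable `z`, some `γ, γ' ∈ Γ_d` satisfy `γ * unip b = unip b * γ'` and
  -- `x̃(γ') / x̃(γ) = x(z²) ≠ 1`.
  obtain ⟨z, hz1, hz, hxz⟩ := exists_extChar_sq_ne_one x hx
  lift z to Fˣ using ((valuation F).ne_zero_iff.1 (hz ▸ one_ne_zero)).isUnit
  have hb0 : b ≠ 0 := (valuation F).ne_zero_iff.1 (zero_lt_one.trans hb).ne'
  have hbinv : valuation F b⁻¹ ≤ uniformizer F := by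
    rw [le_uniformizer_iff, map_inv₀]
    exact inv_lt_one_of_one_lt₀ hb
  have hr : valuation F ((1 - z) / b) ≤ uniformizer F ^ depth x := by
    rw [div_eq_mul_inv, map_mul, Valuation.map_sub_swap, ← Nat.sub_add_cancel hx, pow_succ]
    exact mul_le_mul' hz1 hbinv
  have hγ : lowUnip ((1 - z) / b) * tor z⁻¹ ∈ Gamma F (depth x) :=
    mul_mem (lowUnip_mem_Gamma hr)
      (tor_mem_Gamma_iff.2 (by rw [Units.val_inv_eq_inv_val, map_inv₀, hz, inv_one]))
  have hγ' : lowUnip ((1 - z) / (b * z)) * tor z ∈ Gamma F (depth x) :=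
    mul_mem (lowUnip_mem_Gamma (by rwa [← div_div, map_div₀ _ _ (z : F), hz, div_one]))
      (tor_mem_Gamma_iff.2 hz)
  have htilde (r : F) (a : Fˣ) : tildeChar x (lowUnip r * tor a) = extChar x a := by
    simpa only [unip_zero, mul_one] using tildeChar_lowUnip_mul_tor_mul_unip (x := x) r a 0
  have hleft := opA_f0_mul_left hx hγ (unip b)
  rw [lowUnip_mul_tor_mul_unip_eq hb0, opA_mul_right hx _ hγ', htilde, htilde] at hleft
  have hfixed : extChar x ((z : F) ^ 2) * opA x (f0 x) (unip b) = opA x (f0 x) (unip b) := by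
    rw [sq, extChar_mul x hz, mul_assoc, hleft, ← mul_assoc, ← extChar_mul x hz,
      Units.mul_inv, extChar_one, one_mul]
  exact (mul_left_eq_self₀.1 hfixed).resolve_left hxz

theorem opA_f0 (hx : 0 < depth x) : opA x (f0 x) = phi0 x := by
  funext g
  by_cases hg : g ∈ Gamma F (depth x)
  · rw [phi0, Set.indicator_of_mem (SetLike.mem_coe.2 hg)]
    simpa only [mul_one, opA_f0_one hx] using opA_f0_mul_left hx hg 1
  rw [phi0, Set.indicator_of_notMem (mt SetLike.mem_coe.1 hg)]
  by_contra hne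
  obtain ⟨γ, hγ, b, γ', hγ', rfl⟩ := exists_eq_mul_unip_mul_of_opA_f0_ne_zero hne
  have hb : 1 < valuation F b := lt_of_not_ge fun hb =>
    hg (mul_mem (mul_mem hγ (unip_mem_Gamma_iff.2 hb)) hγ')
  rw [opA_mul_right hx _ hγ', opA_f0_mul_left hx hγ, opA_f0_unip hx hb, mul_zero, mul_zero] at hne
  exact hne rfl

end Convolution

section UnipotentIntegral

section HaarMeasure

variable (F : Type*) [Field F] [ValuativeRel F] [TopologicalSpace F]
  [IsNonarchimedeanLocalField F] [MeasurableSpace F] [BorelSpace F]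

/-- The Haar measure on `F ≃ U` giving volume one to `𝒪 ≃ U ∩ K`. -/
def unitHaar : Measure F :=
  (Measure.addHaar (𝒪[F] : Set F))⁻¹ • Measure.addHaar

instance isAddLeftInvariant_unitHaar : (unitHaar F).IsAddLeftInvariant := by
  rw [unitHaar]
  infer_instance

theorem measurableSet_integers : MeasurableSet (𝒪[F] : Set F) :=
  (isOpen_setOf_valuation_le (F := F) one_ne_zero).measurableSet

theorem unitHaar_integers : unitHaar F (𝒪[F] : Set F) = 1 := by
  have hopen : IsOpen (𝒪[F] : Set F) := isOpen_setOf_valuation_le one_ne_zero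
  have hcompact : IsCompact (𝒪[F] : Set F) := IsNonarchimedeanLocalField.isCompact_closedBall F 1
  rw [unitHaar, Measure.smul_apply, smul_eq_mul]
  exact ENNReal.inv_mul_cancel (hopen.measure_pos _ ⟨0, zero_mem _⟩).ne'
    hcompact.measure_lt_top.ne

/-- The functions on `PGL(2, F)` which are integrable along every coset `g U`, so that `opB` has
no junk values on them. -/
def integrableAlongU : Subrepresentation (leftShift PGL(2, F)) where
  toSubmodule :=
    { carrier := {φ | ∀ g, Integrable (fun b => φ (g * unip b)) (unitHaar F)}
      zero_mem' := fun _ => integrable_zero _ _ _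
      add_mem' := fun h h' g => (h g).add (h' g)
      smul_mem' := fun c _ h g => (h g).const_mul c }
  apply_mem_toSubmodule := fun g φ h g' => by
    simpa only [leftShift_apply, mul_assoc] using h (g⁻¹ * g')

end HaarMeasure

variable {F : Type*} [Field F] [ValuativeRel F] [TopologicalSpace F] {x : 𝒪[F]ˣ →ₜ* ℂˣ}

theorem phi0_mul_unip_of_notMem {g : PGL(2, F)}
    (hg : g ∉ (Gamma F (depth x) : Set PGL(2, F)) * (U F : Set PGL(2, F))) (b : F) :
    phi0 x (g * unip b) = 0 :=
  Set.indicator_of_notMem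
    (fun h => hg ⟨_, h, (unip b)⁻¹, inv_mem ⟨b, rfl⟩, mul_inv_cancel_right _ _⟩) _

variable [IsNonarchimedeanLocalField F]

theorem opB_leftShift (φ : PGL(2, F) → ℂ) (g : PGL(2, F)) :
    opB (leftShift PGL(2, F) g φ) = leftShift PGL(2, F) g (opB φ) := by
  funext h
  simp only [opB, leftShift_apply, mul_assoc]

theorem phi0_mul_unip_mul_unip {γ : PGL(2, F)} (hγ : γ ∈ Gamma F (depth x)) (b₀ b : F) :
    phi0 x (γ * unip b₀ * unip b) =
      Set.indicator (𝒪[F] : Set F) (fun _ => tildeChar x γ) (b + b₀) := by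
  rw [mul_assoc, ← unip_add, add_comm b₀]
  refine Set.indicator_eq_indicator ?_ (congrArg (extChar x) (ratio_mul_unip γ _))
  rw [SetLike.mem_coe, Subgroup.mul_mem_cancel_left _ hγ]
  exact unip_mem_Gamma_iff

section Integral

variable [MeasurableSpace F] [BorelSpace F]

theorem opB_apply (φ : PGL(2, F) → ℂ) (g : PGL(2, F)) :
    opB φ g = ∫ b, φ (g * unip b) ∂unitHaar F := by
  obtain rfl := BorelSpace.measurable_eq (α := F)
  rfl

theorem integrable_indicator_integers (c : ℂ) :
    Integrable (Set.indicator (𝒪[F] : Set F) fun _ => c) (unitHaar F) :=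
  (integrable_indicator_iff (measurableSet_integers F)).2
    (integrableOn_const (by rw [unitHaar_integers]; exact ENNReal.one_ne_top))

theorem phi0_mem_integrableAlongU : phi0 x ∈ integrableAlongU F := by
  intro g
  by_cases hg : g ∈ (Gamma F (depth x) : Set PGL(2, F)) * (U F : Set PGL(2, F))
  · obtain ⟨γ, hγ, _, ⟨b₀, rfl⟩, rfl⟩ := hg
    simp only [phi0_mul_unip_mul_unip hγ]
    exact (integrable_indicator_integers _).comp_add_right b₀
  · simp only [phi0_mul_unip_of_notMem hg]
    exact integrable_zero _ _ _

theorem W_le_integrableAlongU : W x ≤ integrableAlongU F :=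
  W_le_generatedBy_phi0.trans (generatedBy_le (phi0_mem_integrableAlongU))

end Integral

theorem opB_phi0 : opB (phi0 x) = f0 x := by
  borelize F
  funext g
  rw [opB_apply]
  by_cases hg : g ∈ (Gamma F (depth x) : Set PGL(2, F)) * (U F : Set PGL(2, F))
  · obtain ⟨γ, hγ, _, ⟨b₀, rfl⟩, rfl⟩ := hg
    simp only [phi0_mul_unip_mul_unip hγ]
    rw [integral_add_right_eq_self (Set.indicator (𝒪[F] : Set F) fun _ => tildeChar x γ),
      integral_indicator_const _ (measurableSet_integers F), f0_mul x hγ ⟨b₀, rfl⟩, Measure.real,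
      unitHaar_integers, ENNReal.toReal_one, one_smul]
  · simp only [phi0_mul_unip_of_notMem hg, integral_zero]
    exact (Set.indicator_of_notMem hg _).symm

end UnipotentIntegral

section Intertwiners

variable {F : Type*} [Field F] [ValuativeRel F] [TopologicalSpace F]
  [IsNonarchimedeanLocalField F] {x : 𝒪[F]ˣ →ₜ* ℂˣ}

theorem integrable_opA (hx : 0 < depth x) {f : PGL(2, F) → ℂ} (hf : f ∈ V x) (g : PGL(2, F)) :
    Integrable (fun h => f (g * h⁻¹) * phi0 x h) (ch (Gamma F (depth x))) := by
  have := isProbabilityMeasure_ch (isOpen_Gamma (F := F) (depth x)) (isCompact_Gamma _)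
  obtain ⟨hconst, hsupp, -⟩ := phi0_mem_W hx
  have hcont : Continuous fun h => f (g * h⁻¹) :=
    hf.1.continuous.comp (continuous_inv.const_mul g)
  exact (hcont.mul hconst.continuous).integrable_of_hasCompactSupport hsupp.mul_left

/-- `A` as an intertwining map from `V_x` to the functions on `PGL(2, F)`. -/
def intertwiningA (hx : 0 < depth x) : (tau x).IntertwiningMap (leftShift PGL(2, F)) where
  toFun f := opA x f
  map_add' f f' := funext fun g => by
    simp only [opA, conv, Submodule.coe_add, Pi.add_apply, add_mul]
    exact integral_add (integrable_opA hx f.2 g) (integrable_opA hx f'.2 g)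
  map_smul' c f := funext fun g => by
    simp only [opA, conv, Submodule.coe_smul, Pi.smul_apply, smul_eq_mul, mul_assoc]
    exact integral_const_mul _ _
  isIntertwining' g := LinearMap.ext fun f => opA_leftShift (f : PGL(2, F) → ℂ) g

/-- `B` as an intertwining map from `W_x` to the functions on `PGL(2, F)`. -/
def intertwiningB (x : 𝒪[F]ˣ →ₜ* ℂˣ) : (rho x).IntertwiningMap (leftShift PGL(2, F)) where
  toFun φ := opB φ
  map_add' φ φ' := funext fun g => by
    borelize F
    simp only [opB_apply, Submodule.coe_add, Pi.add_apply]
    exact integral_add (W_le_integrableAlongU φ.2 g) (W_le_integrableAlongU φ'.2 g)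
  map_smul' c φ := funext fun g => by
    borelize F
    simp only [opB_apply, Submodule.coe_smul, Pi.smul_apply, smul_eq_mul]
    exact integral_const_mul _ _
  isIntertwining' g := LinearMap.ext fun φ => opB_leftShift (φ : PGL(2, F) → ℂ) g

theorem generatedBy_tau_eq_top (hx : 0 < depth x) :
    generatedBy (tau x) ⟨f0 x, bump_mem_V hx le_rfl⟩ = ⊤ :=
  generatedBy_toRepresentation_eq_top _ (V_le_generatedBy_f0 hx)

theorem generatedBy_rho_eq_top (hx : 0 < depth x) :
    generatedBy (rho x) ⟨phi0 x, phi0_mem_W hx⟩ = ⊤ :=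
  generatedBy_toRepresentation_eq_top _ W_le_generatedBy_phi0

theorem opA_mem_W (hx : 0 < depth x) (f : (V x).toSubmodule) : opA x f ∈ W x :=
  apply_mem_of_generatedBy_eq_top (generatedBy_tau_eq_top hx) (intertwiningA hx)
    ((opA_f0 hx).symm ▸ phi0_mem_W hx : opA x (f0 x) ∈ W x) f

theorem opB_mem_V (hx : 0 < depth x) (φ : (W x).toSubmodule) : opB φ ∈ V x :=
  apply_mem_of_generatedBy_eq_top (generatedBy_rho_eq_top hx) (intertwiningB x)
    ((opB_phi0 (x := x)).symm ▸ bump_mem_V hx le_rfl : opB (phi0 x) ∈ V x) φ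

end Intertwiners

end PGLTwo

end

open PGLTwo in
theorem lemma5p1 {F : Type*} [Field F] [ValuativeRel F] [TopologicalSpace F]
    [IsNonarchimedeanLocalField F] (x : 𝒪[F]ˣ →ₜ* ℂˣ) (hx : 0 < depth x) :
    ∃ (hf₀ : f0 x ∈ (V x).toSubmodule) (hφ₀ : phi0 x ∈ (W x).toSubmodule)
      (A : (tau x).Equiv (rho x)) (B : (rho x).IntertwiningMap (tau x)),
      (∀ f : (V x).toSubmodule, (A f : PGL(2, F) → ℂ) = opA x f) ∧
      (∀ φ : (W x).toSubmodule, (B φ : PGL(2, F) → ℂ) = opB φ) ∧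
      B ⟨phi0 x, hφ₀⟩ = ⟨f0 x, hf₀⟩ ∧
      A ⟨f0 x, hf₀⟩ = ⟨phi0 x, hφ₀⟩ ∧
      ∃ e : (tau x).IntertwiningMap (tau x) ≃ₐ[ℂ] (rho x).IntertwiningMap (rho x),
        ∀ S f, e S (A f) = A (S f) := by
  let A := codRestrict (W x) (intertwiningA hx) (opA_mem_W hx)
  let B := codRestrict (V x) (intertwiningB x) (opB_mem_V hx)
  have hA : A ⟨f0 x, bump_mem_V hx le_rfl⟩ = ⟨phi0 x, phi0_mem_W hx⟩ := Subtype.ext (opA_f0 hx)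
  have hB : B ⟨phi0 x, phi0_mem_W hx⟩ = ⟨f0 x, bump_mem_V hx le_rfl⟩ := Subtype.ext opB_phi0
  let e := equivOfGeneratedByEqTop (generatedBy_tau_eq_top hx) (generatedBy_rho_eq_top hx) A B hA hB
  exact ⟨bump_mem_V hx le_rfl, phi0_mem_W hx, e, B, fun _ => rfl, fun _ => rfl, hB, hA,
    endConj e, endConj_apply_apply e⟩
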